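/- Consider a binary irregular GLDPC code ensemble sequence $(\mathcal M_n)$. There are finitely many check-node (CN) types $t$, each a nonzero binary linear code of length $s_t$ and minimum distance $r_t\ge 2$ having $A^{(t)}_u$ codewords of weight $u$, and finitely many variable-node (VN) types $t$, each a repetition code of length (degree) $q_t\ge 2$. A rational fraction $\rho_t>0$ (resp. $\lambda_t>0$) of the edges is attached to CNs (resp. VNs) of type $t$, with $\sum_t\rho_t=\sum_t\lambda_t=1$. Let $\lambda(x)=\sum_t\lambda_t x^{q_t-1}$ and $\int\lambda=\int_0^1\lambda(x)\,dx$. For those $n\ge1$ for which the following numbers are integers, $\mathcal M_n$ has $n$ VNs and $E=n/\int\lambda$ edges, with $E\rho_t/s_t$ CNs and $E\lambda_t/q_t$ VNs of type $t$; the $E$ VN sockets are joined to the $E$ CN sockets by a uniformly random bijection. A codeword assigns a bit to each VN in such a way that, when every VN repeats its bit on all its edges, each CN receives a codeword of its local code. Let $N_w$ be the number of codewords of Hamming weight $w$, and put $$G(\alpha)=\lim_{n\to\infty}\frac1n\log\mathbb E_{\mathcal M_n}[N_{\alpha n}],$$ the limit being taken over those $n$ for which $\mathcal M_n$ exists, $\alpha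 n\in\mathbb Z$ and $\mathbb E_{\mathcal M_n}[N_{\alpha n}]>0$ (so $\alpha$ is rational). Let $r=\min_t r_t$, $p=\min_t q_t$, $\psi=r/(r-1)$, $C=r\sum_{t:\,r_t=r}\rho_tA^{(t)}_r/s_t$, and let $\tilde\delta=\sum_{t:\,q_t=p}\lambda_t/(q_t\int\lambda)$ be the fraction of VNs of degree $p$. Let $\bar r$ be the smallest integer $u>r$ with $A^{(t)}_u>0$ for some CN type $t$, let $\bar p$ be the smallest VN degree larger than $p$, and put $$\xi=\min\Big\{\frac{\bar r}{r},\ \frac{\bar p-p}{\psi}+1,\ 2\Big\},$$ where the first (second) term is omitted if no such $\bar r$ ($\bar p$) exists. Then $$G(\alpha)=\Big(p-\frac pr-1\Big)\alpha\log\alpha+K\alpha+O(\alpha^{\xi}),\qquad K=\log(e\tilde\delta)+\frac pr\log C+\frac p\psi\log\Big(\frac{p\int\lambda}{e}\Big).$$ That is, there are $k,\varepsilon>0$, depending only on the ensemble sequence, such that for every rational $0\le\alpha\le\varepsilon$ infinitely many $n$ qualify for the limit, the limit $G(\alpha)$ exists, and it differs from $(p-\frac pr-1)\alpha\log\alpha+K\alpha$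 by at most $k\alpha^\xi$ in absolute value (with $0\log 0=0$). -/

import Mathlib

open Filter Topology

/-- The parameters of an irregular binary GLDPC code ensemble sequence: finitely many check-node
types, each a nonzero binary linear code of minimum distance at least `2`, finitely many
variable-node types, each a repetition code of length (degree) at least `2`, and the fractions
`rho t`, `lam t` of edges attached to the check nodes, resp. variable nodes, of type `t`. The edge
fractions are rational, since the numbers of nodes of each type have to be integers. -/
structure GLDPCEnsemble where
  /-- number of check-node types -/
  nc : ℕ
  /-- number of variable-node types -/
  nv : ℕ
  /-- length of the check-node codes -/
  s : Fin nc → ℕ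
  /-- the local code of the check nodes of each type -/
  code : (t : Fin nc) → Submodule (ZMod 2) (Fin (s t) → ZMod 2)
  code_ne_bot : ∀ t, code t ≠ ⊥
  two_le_weight : ∀ t, ∀ c ∈ code t, c ≠ 0 → 2 ≤ hammingNorm c
  /-- length of the repetition codes, i.e. the variable-node degrees -/
  q : Fin nv → ℕ
  two_le_q : ∀ t, 2 ≤ q t
  /-- fraction of edges connected to check nodes of type `t` -/
  rho : Fin nc → ℚ
  rho_pos : ∀ t, 0 < rho t
  rho_sum : ∑ t, rho t = 1
  /-- fraction of edges connected to variable nodes of type `t` -/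
  lam : Fin nv → ℚ
  lam_pos : ∀ t, 0 < lam t
  lam_sum : ∑ t, lam t = 1

namespace GLDPCEnsemble

noncomputable section

variable (M : GLDPCEnsemble)

/-! ### Parameters of the ensemble -/

/-- The integral over `[0, 1]` of `λ(x) = ∑ t, λ_t x ^ (q_t - 1)`. -/
def intLam : ℝ := ∫ x in (0 : ℝ)..1, ∑ t, (M.lam t : ℝ) * x ^ (M.q t - 1)

/-- Number `A_u^(t)` of codewords of weight `u` of the check-node code of type `t`. -/
def A (t : Fin M.nc) (u : ℕ) : ℕ := Nat.card {c // c ∈ M.code t ∧ hammingNorm c = u}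

/-- Minimum distance `r_t` of the check-node code of type `t`. -/
def minDist (t : Fin M.nc) : ℕ := sInf {w | ∃ c ∈ M.code t, c ≠ 0 ∧ hammingNorm c = w}

/-- The smallest minimum distance `r` over all check-node types. -/
def r : ℕ := ⨅ t, M.minDist t

/-- The minimum variable-node degree `p`. -/
def p : ℕ := ⨅ t, M.q t

/-- `ψ = r / (r - 1)`. -/
def psi : ℝ := (M.r : ℝ) / ((M.r : ℝ) - 1)

/-- `C = r ∑ ρ_t A_r^(t) / s_t`, the sum over the check-node types of minimum distance `r`. -/
def C : ℝ := (M.r : ℝ) *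
  ∑ t ∈ Finset.univ.filter (fun t => M.minDist t = M.r),
    (M.rho t : ℝ) * (M.A t M.r : ℝ) / (M.s t : ℝ)

/-- Fraction `δ_t` of variable nodes of type `t`. -/
def delta (t : Fin M.nv) : ℝ := (M.lam t : ℝ) / ((M.q t : ℝ) * M.intLam)

/-- Fraction of the variable nodes that have the minimum degree `p`. -/
def deltaTilde : ℝ := ∑ t ∈ Finset.univ.filter (fun t => M.q t = M.p), M.delta t

/-- The exponent `ξ` of the error term, `ξ = min {rbar / r, χ / ψ + 1, 2}`. Here `rbar` is the
smallest weight larger than `r` of a codeword of a check-node code, and `χ = pbar - p` where `pbar`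
is the smallest variable-node degree larger than `p`; a term whose defining set is empty is
omitted. The minimum is written as that of the finite nonempty set which consists of `2` and of
all the candidates for the other two terms. -/
def xi : ℝ := sInf ({2}
  ∪ {x | ∃ t u, M.r < u ∧ 0 < M.A t u ∧ x = (u : ℝ) / (M.r : ℝ)}
  ∪ {x | ∃ t, M.p < M.q t ∧ x = ((M.q t : ℝ) - (M.p : ℝ)) / M.psi + 1})

/-- The coefficient `K` of the linear term. -/
def K : ℝ := Real.log (Real.exp 1 * M.deltaTilde) + (M.p : ℝ) / (M.r : ℝ) * Real.log M.C
  + (M.p : ℝ) / M.psi * Real.log ((M.p : ℝ) * M.intLam / Real.exp 1)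

/-! ### The random code with `n` variable nodes -/

/-- Number of edges `E = n / ∫ λ`. -/
def edges (n : ℕ) : ℝ := (n : ℝ) / M.intLam

/-- Number of check nodes of type `t` (used only when `E ρ_t / s_t` is an integer). -/
def numCN (n : ℕ) (t : Fin M.nc) : ℕ := ⌊M.edges n * (M.rho t : ℝ) / (M.s t : ℝ)⌋₊

/-- Number of variable nodes of type `t` (used only when `E λ_t / q_t` is an integer). -/
def numVN (n : ℕ) (t : Fin M.nv) : ℕ := ⌊M.edges n * (M.lam t : ℝ) / (M.q t : ℝ)⌋₊

/-- The ensemble with `n` variable nodes exists: all the numbers of nodes are integers. -/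
def Admissible (n : ℕ) : Prop :=
  0 < n ∧ (∀ t, (M.numCN n t : ℝ) = M.edges n * (M.rho t : ℝ) / (M.s t : ℝ)) ∧
    (∀ t, (M.numVN n t : ℝ) = M.edges n * (M.lam t : ℝ) / (M.q t : ℝ))

/-- The variable nodes; each carries one code bit. -/
abbrev VNode (n : ℕ) : Type := (t : Fin M.nv) × Fin (M.numVN n t)

/-- The variable-node sockets (ends of edges). -/
abbrev VSocket (n : ℕ) : Type := (t : Fin M.nv) × (Fin (M.numVN n t) × Fin (M.q t))

/-- The check-node sockets (ends of edges). -/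
abbrev CSocket (n : ℕ) : Type := (t : Fin M.nc) × (Fin (M.numCN n t) × Fin (M.s t))

/-- A Tanner graph of the ensemble: a bijection of the variable-node sockets with the check-node
sockets. -/
abbrev Graph (n : ℕ) : Type := M.VSocket n ≃ M.CSocket n

/-- The word `x` is a codeword of the code with Tanner graph `π`: if every variable node repeats
its bit on all its edges, then every check node sees a word of its local code. -/
def IsCodeword {n : ℕ} (π : M.Graph n) (x : M.VNode n → ZMod 2) : Prop :=
  ∀ (t : Fin M.nc) (a : Fin (M.numCN n t)),
    (fun j : Fin (M.s t) => x ⟨(π.symm ⟨t, a, j⟩).1, (π.symm ⟨t, a, j⟩).2.1⟩) ∈ M.code t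

/-- Number `N_w` of codewords of weight `w` of the code with Tanner graph `π`. -/
def numCodewords {n : ℕ} (π : M.Graph n) (w : ℕ) : ℕ :=
  Nat.card {x : M.VNode n → ZMod 2 // M.IsCodeword π x ∧ hammingNorm x = w}

/-- Expectation of `N_w` for a uniformly distributed Tanner graph with `n` variable nodes. -/
def expectedNum (n w : ℕ) : ℝ :=
  (∑ π : M.Graph n, (M.numCodewords π w : ℝ)) / (Fintype.card (M.Graph n) : ℝ)

/-! ### The growth rate -/

/-- `n → ∞` through the `n` for which the ensemble exists, `α n` is a (nonnegative) integer and
the expected number of codewords of weight `α n` is positive. -/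
def growthFilter (α : ℝ) : Filter ℕ :=
  atTop ⊓ 𝓟 {n | M.Admissible n ∧ ∃ w : ℕ, (w : ℝ) = α * n ∧ 0 < M.expectedNum n w}

/-- `(1 / n) log 𝔼[N_{α n}]`. -/
def normalizedLog (α : ℝ) (n : ℕ) : ℝ := 1 / (n : ℝ) * Real.log (M.expectedNum n ⌊α * n⌋₊)

/-- The growth rate `G(α)` of the weight distribution (meaningful where the limit exists). -/
def growthRate (α : ℝ) : ℝ := limUnder (M.growthFilter α) (M.normalizedLog α)

end

end GLDPCEnsemble

/-! Averaging over the socket bijections gives the exact formula E[N_w] = ∑_L V(w,L) A(L) /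
binom(E,L) (`expectedNum_eq_sum`), where V counts the words of weight w that put ones on L edges and
A counts the locally valid socket words of weight L. Everything is read off from this sum.

Existence of the limit. Concatenating configurations makes V and A supermultiplicative, while
binom(E,L) equals its entropy exponential up to a factor E+1. Hence log E[N] is superadditive along
n = k n₀ + m up to a logarithmic error (`exists_mul_pow_le_expectedNum`), and a Fekete argument
gives convergence along all qualifying n, not just along a subsequence.

Upper bound. A and V are bounded by their generating functions at positive points z and x. Only p w
≤ L ≤ Q w occurs, with Q = ∑ q_t, and there binom(E,pw) ≤ κ^(L-pw) binom(E,L) with κ of order α, so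
each edge beyond the minimum p w costs a factor κ/z (`Admissible.expectedNum_mul_le`). The leading
part of the exponent is minimal at z^r = p∫λ α/C and x = α/δ̃, which gives κ/z = O(α^(1/ψ)). Local
words of weight u > r then contribute O(α^(u/r)), variable nodes of degree q > p contribute
O(α^((q-p)/ψ+1)), and the entropy expansion contributes O(α²): these are the terms in the minimum
defining ξ (`exists_upperExponent_le`).

Lower bound. The one summand L = p w suffices, restricted to ones on nodes of degree p and to local
words of weight r, spread over the types in the proportions that the saddle point dictates.
Rationality of α makes these numbers integers for arbitrarily large n, and the loss is O(α²)
(`exists_growth_ge`). -/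

/-! ### Weighted configurations and their generating functions -/

section Counting

variable {T : Type*} [Fintype T] {Ω : T → Type*} [∀ t, Fintype (Ω t)] {G : Type*} [AddCommMonoid G]

/-- Number of ways to choose, for each type `t`, a list of `m t` elements of `Ω t` in such a way
that the total weight is `g`. -/
noncomputable def configCount (wt : ∀ t, Ω t → G) (m : T → ℕ) (g : G) : ℕ :=
  Nat.card {ω : ∀ t, Fin (m t) → Ω t // ∑ t, ∑ a, wt t (ω t a) = g}

variable (wt : ∀ t, Ω t → G)

/-- Appending the lists type by type is injective and adds weights. This is the source of the
supermultiplicativity behind the existence of the limit. -/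
theorem configCount_mul_le (m m' : T → ℕ) (g g' : G) :
    configCount wt m g * configCount wt m' g' ≤ configCount wt (m + m') (g + g') := by
  classical
  unfold configCount
  rw [← Nat.card_prod]
  refine Nat.card_le_card_of_injective
    (fun x => ⟨fun t => Fin.append (x.1.1 t) (x.2.1 t), ?_⟩) ?_
  · have hx := congrArg₂ (· + ·) x.1.2 x.2.2
    simp only [← Finset.sum_add_distrib] at hx
    rw [← hx]
    refine Finset.sum_congr rfl fun t _ => ?_
    have := Fin.sum_univ_add (fun a => wt t (Fin.append (x.1.1 t) (x.2.1 t) a))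
    simpa using this
  · rintro ⟨⟨a, ha⟩, ⟨b, hb⟩⟩ ⟨⟨c, hc⟩, ⟨d, hd⟩⟩ h
    simp only [Subtype.mk.injEq, Prod.mk.injEq] at h ⊢
    constructor
    · funext t i
      have := congrFun (congrFun h t) (Fin.castAdd _ i)
      simpa using this
    · funext t i
      have := congrFun (congrFun h t) (Fin.natAdd _ i)
      simpa using this

theorem configCount_pow_mul_le (k : ℕ) (m m' : T → ℕ) (g g' : G) :
    configCount wt m g ^ k * configCount wt m' g' ≤ configCount wt (k • m + m') (k • g + g') := by
  induction k with
  | zero => simp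
  | succ k ih =>
    calc configCount wt m g ^ (k + 1) * configCount wt m' g'
        = configCount wt m g * (configCount wt m g ^ k * configCount wt m' g') := by ring
      _ ≤ configCount wt m g * configCount wt (k • m + m') (k • g + g') := by gcongr
      _ ≤ configCount wt (m + (k • m + m')) (g + (k • g + g')) := configCount_mul_le wt _ _ _ _
      _ = _ := by
        congr 1
        · rw [succ_nsmul']; abel
        · rw [succ_nsmul', add_assoc]

theorem map_sum_eq_prod_of_char {χ : G → ℝ} (h0 : χ 0 = 1)
    (hadd : ∀ a b, χ (a + b) = χ a * χ b) {ι : Type*} (u : Finset ι) (f : ι → G) :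
    χ (∑ i ∈ u, f i) = ∏ i ∈ u, χ (f i) := by
  classical
  induction u using Finset.induction_on with
  | empty => simp [h0]
  | insert a u ha ih => rw [Finset.sum_insert ha, Finset.prod_insert ha, hadd, ih]

/-- The generating function of `configCount`, evaluated at a character of the weight monoid. -/
theorem sum_configCount_mul (χ : G → ℝ) (h0 : χ 0 = 1) (hadd : ∀ a b, χ (a + b) = χ a * χ b)
    (hχ : ∀ a, 0 ≤ χ a) (m : T → ℕ) (s : Finset G) :
    ∑ g ∈ s, configCount wt m g * χ g ≤ ∏ t, (∑ o, χ (wt t o)) ^ m t := by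
  classical
  let W : (∀ t, Fin (m t) → Ω t) → G := fun ω => ∑ t, ∑ a, wt t (ω t a)
  have hW : ∀ ω, χ (W ω) = ∏ t, ∏ a, χ (wt t (ω t a)) := by
    intro ω
    simp only [W]
    rw [map_sum_eq_prod_of_char h0 hadd]
    exact Finset.prod_congr rfl fun t _ => map_sum_eq_prod_of_char h0 hadd _ _
  have hprod : ∏ t, (∑ o, χ (wt t o)) ^ m t = ∑ ω, χ (W ω) := by
    simp only [hW]
    rw [← Fintype.prod_sum (fun t (x : Fin (m t) → Ω t) => ∏ a, χ (wt t (x a)))]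
    refine Finset.prod_congr rfl fun t _ => ?_
    rw [← Fintype.prod_sum (fun (_ : Fin (m t)) o => χ (wt t o))]
    simp
  have hcount : ∀ g, (configCount wt m g : ℝ) * χ g = ∑ ω with W ω = g, χ (W ω) := by
    intro g
    rw [Finset.sum_congr rfl (g := fun _ => χ g)
      (fun ω hω => by rw [(Finset.mem_filter.1 hω).2])]
    rw [Finset.sum_const, nsmul_eq_mul]
    congr 2
    unfold configCount
    rw [Nat.card_eq_fintype_card, Fintype.card_subtype]
  rw [hprod, Finset.sum_congr rfl fun g _ => hcount g]
  rw [Finset.sum_fiberwise_eq_sum_filter Finset.univ s W (fun ω => χ (W ω))]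
  exact Finset.sum_le_sum_of_subset_of_nonneg (Finset.filter_subset _ _) fun _ _ _ => hχ _

theorem configCount_mul_char_le (χ : G → ℝ) (h0 : χ 0 = 1)
    (hadd : ∀ a b, χ (a + b) = χ a * χ b) (hχ : ∀ a, 0 ≤ χ a) (m : T → ℕ) (g : G) :
    configCount wt m g * χ g ≤ ∏ t, (∑ o, χ (wt t o)) ^ m t := by
  simpa using sum_configCount_mul wt χ h0 hadd hχ m {g}

/-- Number of lists of `m` elements of `Ω` of total weight `g`. -/
noncomputable def listCount {Ω : Type*} (wt : Ω → G) (m : ℕ) (g : G) : ℕ :=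
  Nat.card {ω : Fin m → Ω // ∑ a, wt (ω a) = g}

/-- Prescribing how the total weight splits over the types only loses configurations; the lower
bound on the growth rate uses a single such split. -/
theorem prod_listCount_le (m : T → ℕ) (g : T → G) :
    ∏ t, listCount (wt t) (m t) (g t) ≤ configCount wt m (∑ t, g t) := by
  classical
  unfold listCount configCount
  rw [← Nat.card_pi]
  refine Nat.card_le_card_of_injective
    (fun x => ⟨fun t => (x t).1, Finset.sum_congr rfl fun t _ => (x t).2⟩) ?_
  intro x y h
  funext t
  exact Subtype.ext (congrFun (congrArg Subtype.val h) t)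

theorem listCount_zero_pos {Ω : Type*} [Finite Ω] (wt : Ω → G) (o : Ω) (ho : wt o = 0) (m : ℕ) :
    0 < listCount wt m 0 := by
  unfold listCount
  rw [Nat.card_pos_iff]
  exact ⟨⟨⟨fun _ => o, by simp [ho]⟩⟩, inferInstance⟩

/-- Choose the k positions that carry an element of weight `g` and put `o` everywhere else. The
induction follows Pascal's rule. -/
theorem choose_mul_pow_le_listCount {Ω : Type*} [Finite Ω] (wt : Ω → G) (o : Ω) (ho : wt o = 0)
    (g : G) (hg : g ≠ 0) (m k : ℕ) :
    m.choose k * Nat.card {x // wt x = g} ^ k ≤ listCount wt m (k • g) := by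
  classical
  induction m generalizing k with
  | zero =>
    cases k with
    | zero =>
      have := listCount_zero_pos wt o ho 0
      simp only [Nat.choose_zero_right, pow_zero, mul_one, zero_smul]
      omega
    | succ k => simp
  | succ m ih =>
    cases k with
    | zero =>
      have := listCount_zero_pos wt o ho (m + 1)
      simp only [Nat.choose_zero_right, pow_zero, mul_one, zero_smul]
      omega
    | succ k =>
      -- The first entry is either `o` or an element of weight `g`; the two cases are disjoint
      -- because `g ≠ 0`.
      have key : listCount wt m ((k + 1) • g) + Nat.card {x // wt x = g} * listCount wt m (k • g) ≤
          listCount wt (m + 1) ((k + 1) • g) := by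
        have hcons : ∀ {a b : Ω} {f h : Fin m → Ω},
            (Fin.cons a f : Fin (m + 1) → Ω) = Fin.cons b h → a = b ∧ f = h :=
          fun e => Fin.cons_injective2 e
        unfold listCount
        rw [← Nat.card_prod, ← Nat.card_sum]
        refine Nat.card_le_card_of_injective
          (Sum.elim (fun x => ⟨Fin.cons o x.1, ?_⟩) (fun x => ⟨Fin.cons x.1.1 x.2.1, ?_⟩)) ?_
        · rw [Fin.sum_univ_succ]; simp [ho, x.2]
        · rw [Fin.sum_univ_succ]; simp [x.1.2, x.2.2, succ_nsmul']
        · refine Function.Injective.sumElim ?_ ?_ ?_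
          · intro x y h
            exact Subtype.ext (hcons (congrArg Subtype.val h)).2
          · rintro ⟨⟨a, ha⟩, ⟨b, hb⟩⟩ ⟨⟨c, hc⟩, ⟨d, hd⟩⟩ h
            have := hcons (congrArg Subtype.val h)
            simp only [Prod.mk.injEq, Subtype.mk.injEq]
            exact this
          · intro x y h
            have := (hcons (congrArg Subtype.val h)).1
            exact hg (by rw [← y.1.2, ← this, ho])
      refine le_trans ?_ key
      calc (m + 1).choose (k + 1) * Nat.card {x // wt x = g} ^ (k + 1)
          = m.choose (k + 1) * Nat.card {x // wt x = g} ^ (k + 1) +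
            Nat.card {x // wt x = g} * (m.choose k * Nat.card {x // wt x = g} ^ k) := by
            rw [Nat.choose_succ_succ]; ring
        _ ≤ _ := by gcongr <;> apply ih

end Counting

/-! ### Bijections carrying one bit string to another -/

section BitStrings

variable {α β : Type*} [Fintype α] [Fintype β]

theorem card_zmod_two_fibers (f : α → ZMod 2) :
    Fintype.card {a // f a = 1} = hammingNorm f ∧
      Fintype.card {a // f a = 0} = Fintype.card α - hammingNorm f := by
  have h1 : ∀ a, f a = 1 ↔ f a ≠ 0 := by
    intro a
    generalize f a = b
    revert b
    decide
  have e1 : Fintype.card {a // f a = 1} = hammingNorm f := by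
    rw [Fintype.card_subtype, hammingNorm]
    congr 1
    ext a
    simp [h1]
  refine ⟨e1, ?_⟩
  have h2 : Fintype.card {a // ¬ f a = 1} = Fintype.card α - Fintype.card {a // f a = 1} :=
    Fintype.card_subtype_compl _
  rw [← e1, ← h2]
  refine Fintype.card_congr (Equiv.subtypeEquivRight fun a => ?_)
  rw [h1]; simp

/-- The number of bijections that carry one bit string to another. -/
theorem card_equiv_comp_symm_eq [DecidableEq α] [DecidableEq β]
    (h : Fintype.card α = Fintype.card β) (f : α → ZMod 2)
    (c : β → ZMod 2) :
    Fintype.card {π : α ≃ β // f ∘ π.symm = c} = if hammingNorm c = hammingNorm f then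
      (hammingNorm f).factorial * (Fintype.card α - hammingNorm f).factorial else 0 := by
  split_ifs with hw
  · have hfib : ∀ b : ZMod 2, Nonempty ({a // f a = b} ≃ {a // c a = b}) := by
      intro b
      rw [← Fintype.card_eq]
      have hb : b = 0 ∨ b = 1 := by revert b; decide
      rcases hb with rfl | rfl
      · rw [(card_zmod_two_fibers f).2, (card_zmod_two_fibers c).2, hw, h]
      · rw [(card_zmod_two_fibers f).1, (card_zmod_two_fibers c).1, hw]
    -- One reference bijection; the others differ from it by a permutation preserving `f`, so the
    -- count is the order of a stabilizer.
    let π₀ : α ≃ β := Equiv.ofFiberEquiv (f := f) (g := c) fun b => (hfib b).some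
    have hπ₀ : ∀ a, c (π₀ a) = f a := fun a => Equiv.ofFiberEquiv_map _ a
    let e : {π : α ≃ β // f ∘ π.symm = c} ≃ {g : Equiv.Perm α // f ∘ g = f} :=
      { toFun := fun π => ⟨π₀.trans π.1.symm, by
          funext a
          have := congrFun π.2 (π₀ a)
          simpa [hπ₀] using this⟩
        invFun := fun g => ⟨g.1.symm.trans π₀, by
          funext b
          have := congrFun g.2 (π₀.symm b)
          have h3 := hπ₀ (π₀.symm b)
          simp at h3
          simpa [← h3] using this⟩
        left_inv := fun π => by ext; simp
        right_inv := fun g => by ext; simp }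
    rw [Fintype.card_congr e, DomMulAct.stabilizer_card f]
    have huniv : (Finset.univ : Finset (ZMod 2)) = {0, 1} := by decide
    rw [huniv, Finset.prod_pair (by decide), (card_zmod_two_fibers f).1,
      (card_zmod_two_fibers f).2, mul_comm]
  · rw [Fintype.card_eq_zero_iff]
    refine ⟨fun π => hw ?_⟩
    rw [← (card_zmod_two_fibers f).1, ← (card_zmod_two_fibers c).1]
    refine Fintype.card_congr (π.1.symm.subtypeEquiv fun b => ?_)
    rw [← congrFun π.2 b]
    rfl

end BitStrings

/-! ### The exact formula for the expected number of codewords -/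

namespace GLDPCEnsemble

variable (M : GLDPCEnsemble)

/-- Weight of a bit at a variable node, together with the number of edges that carry a one. -/
def vnWeight (t : Fin M.nv) (b : ZMod 2) : ℕ × ℕ := if b = 0 then 0 else (1, M.q t)

/-- Weight of a local codeword. -/
def cnWeight (t : Fin M.nc) (c : M.code t) : ℕ := hammingNorm c.1

noncomputable instance (t : Fin M.nc) : Fintype (M.code t) := Fintype.ofFinite _

/-- Number of words of weight `w` on `m t` variable nodes of each type that put a one on exactly `L`
edges. -/
noncomputable def vnCount (m : Fin M.nv → ℕ) (w L : ℕ) : ℕ := configCount M.vnWeight m (w, L)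

/-- Number of valid assignments of weight `L` to the sockets of `m t` check nodes of each type. -/
noncomputable def cnCount (m : Fin M.nc → ℕ) (L : ℕ) : ℕ := configCount M.cnWeight m L

/-- Number of edges as a natural number. -/
noncomputable def numEdges (n : ℕ) : ℕ := ∑ t, M.numVN n t * M.q t

variable {M}

/-- The bits on the edges. -/
def edgeBits {n : ℕ} (x : M.VNode n → ZMod 2) (s : M.VSocket n) : ZMod 2 := x ⟨s.1, s.2.1⟩

theorem hammingNorm_eq_sum {ι : Type*} [Fintype ι] (x : ι → ZMod 2) :
    hammingNorm x = ∑ i, if x i = 0 then 0 else 1 := by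
  unfold hammingNorm
  rw [Finset.card_filter]
  exact Finset.sum_congr rfl fun i _ => by split_ifs <;> simp_all

theorem vnWeight_sum {n : ℕ} (x : M.VNode n → ZMod 2) :
    ∑ t, ∑ a, M.vnWeight t (x ⟨t, a⟩) = (hammingNorm x, hammingNorm (edgeBits x)) := by
  rw [hammingNorm_eq_sum, hammingNorm_eq_sum, Fintype.sum_sigma, Fintype.sum_sigma]
  ext
  · simp only [Prod.fst_sum]
    refine Finset.sum_congr rfl fun t _ => Finset.sum_congr rfl fun a _ => ?_
    unfold vnWeight
    split_ifs <;> rfl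
  · simp only [Prod.snd_sum]
    refine Finset.sum_congr rfl fun t _ => ?_
    rw [Fintype.sum_prod_type]
    refine Finset.sum_congr rfl fun a _ => ?_
    unfold vnWeight edgeBits
    split_ifs <;> simp

theorem card_words_eq_vnCount (n w L : ℕ) :
    Nat.card {x : M.VNode n → ZMod 2 // hammingNorm x = w ∧ hammingNorm (edgeBits x) = L} =
      M.vnCount (M.numVN n) w L := by
  unfold vnCount configCount
  refine Nat.card_congr ((Equiv.piCurry fun t (_ : Fin (M.numVN n t)) => ZMod 2).subtypeEquiv
    fun x => ?_)
  have := vnWeight_sum x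
  change _ ↔ ∑ t, ∑ a, M.vnWeight t (x ⟨t, a⟩) = _
  rw [this]
  simp

/-- The socket assignments in which each check node sees a word of its local code. -/
def LocallyValid {n : ℕ} (c : M.CSocket n → ZMod 2) : Prop :=
  ∀ (t : Fin M.nc) (a : Fin (M.numCN n t)), (fun j => c ⟨t, a, j⟩) ∈ M.code t

theorem card_locallyValid_eq_cnCount (n L : ℕ) :
    Nat.card {c : M.CSocket n → ZMod 2 // LocallyValid c ∧ hammingNorm c = L} =
      M.cnCount (M.numCN n) L := by
  unfold cnCount configCount
  refine Nat.card_congr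
    { toFun := fun c => ⟨fun t a => ⟨fun j => c.1 ⟨t, a, j⟩, c.2.1 t a⟩, ?_⟩
      invFun := fun ω => ⟨fun s => (ω.1 s.1 s.2.1).1 s.2.2, fun t a => (ω.1 t a).2, ?_⟩
      left_inv := fun c => rfl
      right_inv := fun ω => rfl }
  · refine Eq.trans ?_ ((hammingNorm_eq_sum _).symm.trans c.2.2)
    rw [Fintype.sum_sigma]
    refine Finset.sum_congr rfl fun t _ => ?_
    rw [Fintype.sum_prod_type]
    refine Finset.sum_congr rfl fun a _ => ?_
    rw [cnWeight, hammingNorm_eq_sum]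
  · refine Eq.trans ?_ ω.2
    rw [hammingNorm_eq_sum, Fintype.sum_sigma]
    refine Finset.sum_congr rfl fun t _ => ?_
    rw [Fintype.sum_prod_type]
    refine Finset.sum_congr rfl fun a _ => ?_
    rw [cnWeight, hammingNorm_eq_sum]

theorem isCodeword_iff {n : ℕ} (π : M.Graph n) (x : M.VNode n → ZMod 2) :
    M.IsCodeword π x ↔ LocallyValid (edgeBits x ∘ π.symm) := Iff.rfl

theorem card_vSocket (n : ℕ) : Fintype.card (M.VSocket n) = M.numEdges n := by
  simp [numEdges]

theorem hammingNorm_edgeBits_le {n : ℕ} (x : M.VNode n → ZMod 2) :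
    hammingNorm (edgeBits x) ≤ M.numEdges n := by
  rw [← card_vSocket]
  exact hammingNorm_le_card_fintype

/-- Sort the bijections by the socket word they induce from `x`. Each locally valid word with the
right number L of ones arises from L!(E-L)! bijections, and no other word is admissible. -/
theorem card_graph_isCodeword {n : ℕ} (h : Fintype.card (M.CSocket n) = M.numEdges n)
    (x : M.VNode n → ZMod 2) :
    Nat.card {π : M.Graph n // M.IsCodeword π x} =
      M.cnCount (M.numCN n) (hammingNorm (edgeBits x)) *
        ((hammingNorm (edgeBits x)).factorial *
          (M.numEdges n - hammingNorm (edgeBits x)).factorial) := by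
  classical
  have h1 : Nat.card {π : M.Graph n // M.IsCodeword π x} =
      ∑ c : M.CSocket n → ZMod 2 with LocallyValid c,
        Fintype.card {π : M.Graph n // edgeBits x ∘ π.symm = c} := by
    rw [Nat.card_eq_fintype_card, Fintype.card_subtype,
      Finset.card_eq_sum_card_fiberwise (f := fun π : M.Graph n => edgeBits x ∘ π.symm)
        (t := Finset.univ.filter fun c => LocallyValid c)]
    · refine Finset.sum_congr rfl fun c hc => ?_
      rw [Fintype.card_subtype, Finset.filter_filter]
      congr 1
      ext π
      simp only [Finset.mem_filter, Finset.mem_univ, true_and] at hc ⊢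
      refine ⟨fun h => h.2, fun h => ⟨?_, h⟩⟩
      rw [isCodeword_iff, h]
      exact hc
    · intro π hπ
      simpa [isCodeword_iff] using hπ
  rw [h1, Finset.sum_congr rfl fun c _ =>
    card_equiv_comp_symm_eq ((card_vSocket n).trans h.symm) (edgeBits x) c]
  rw [← Finset.sum_filter, Finset.sum_const, Finset.filter_filter, ← card_locallyValid_eq_cnCount,
    Nat.card_eq_fintype_card, Fintype.card_subtype, smul_eq_mul, card_vSocket]

/-- By double counting, sum over words the probability of being a codeword. That probability depends
only on the number L of edges carrying a one, so the words are grouped by L. -/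
theorem expectedNum_eq_sum {n : ℕ} (h : Fintype.card (M.CSocket n) = M.numEdges n) (w : ℕ) :
    M.expectedNum n w = ∑ L ∈ Finset.range (M.numEdges n + 1),
      (M.vnCount (M.numVN n) w L : ℝ) * M.cnCount (M.numCN n) L / (M.numEdges n).choose L := by
  classical
  have hg : Fintype.card (M.Graph n) = (M.numEdges n).factorial := by
    rw [Fintype.card_equiv (Fintype.equivOfCardEq ((card_vSocket n).trans h.symm)), card_vSocket]
  have h1 : ∑ π : M.Graph n, (M.numCodewords π w : ℝ) =
      ∑ x : M.VNode n → ZMod 2 with hammingNorm x = w,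
        (Nat.card {π : M.Graph n // M.IsCodeword π x} : ℝ) := by
    have h2 : ∀ π : M.Graph n, (M.numCodewords π w : ℝ) =
        ∑ x : M.VNode n → ZMod 2 with hammingNorm x = w, if M.IsCodeword π x then (1 : ℝ) else 0 := by
      intro π
      rw [numCodewords, Nat.card_eq_fintype_card, Fintype.card_subtype, Finset.sum_boole,
        Finset.filter_filter]
      simp only [and_comm]
    rw [Finset.sum_congr rfl fun π _ => h2 π, Finset.sum_comm]
    refine Finset.sum_congr rfl fun x _ => ?_
    rw [Finset.sum_boole, Nat.card_eq_fintype_card, Fintype.card_subtype]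
  rw [expectedNum, h1, hg, Finset.sum_div]
  rw [← Finset.sum_fiberwise_of_maps_to (s := Finset.univ.filter fun x => hammingNorm x = w)
    (t := Finset.range (M.numEdges n + 1)) (g := fun x => hammingNorm (edgeBits x))
    (fun x _ => Finset.mem_range.2 (Nat.lt_succ_of_le (hammingNorm_edgeBits_le x)))]
  refine Finset.sum_congr rfl fun L hL => ?_
  have hL : L ≤ M.numEdges n := Nat.lt_succ_iff.1 (Finset.mem_range.1 hL)
  have h3 : ∀ x ∈ (Finset.univ.filter fun x : M.VNode n → ZMod 2 => hammingNorm x = w).filter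
      (fun x => hammingNorm (edgeBits x) = L),
      (Nat.card {π : M.Graph n // M.IsCodeword π x} : ℝ) / ((M.numEdges n).factorial : ℕ) =
      (M.cnCount (M.numCN n) L : ℝ) / (M.numEdges n).choose L := by
    intro x hx
    have hx := (Finset.mem_filter.1 hx).2
    rw [card_graph_isCodeword h, hx, ← Nat.choose_mul_factorial_mul_factorial hL]
    have a1 := Nat.factorial_ne_zero L
    have a2 := Nat.factorial_ne_zero (M.numEdges n - L)
    have a3 := (Nat.choose_pos hL).ne'
    push_cast
    field_simp
  rw [Finset.sum_congr rfl h3, Finset.sum_const, Finset.filter_filter, ← card_words_eq_vnCount,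
    Nat.card_eq_fintype_card, Fintype.card_subtype, nsmul_eq_mul, mul_div_assoc]

end GLDPCEnsemble

/-! ### Entropy bounds for binomial coefficients -/

section Binomial

/-- Equivalently, i ↦ n^i / i! is largest at i = n: the factors of n!/i! are at most n, and those of
i!/n! are at least n. -/
theorem factorial_mul_pow_le_factorial_mul_pow_self (n i : ℕ) :
    n.factorial * n ^ i ≤ i.factorial * n ^ n := by
  rcases le_total i n with h | h
  · have h1 := Nat.factorial_mul_descFactorial (Nat.sub_le n i)
    have h2 := Nat.descFactorial_le_pow n (n - i)
    rw [Nat.sub_sub_self h] at h1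
    rw [← h1]
    calc i.factorial * n.descFactorial (n - i) * n ^ i
        ≤ i.factorial * n ^ (n - i) * n ^ i := by gcongr
      _ = i.factorial * n ^ n := by rw [mul_assoc, ← pow_add, Nat.sub_add_cancel h]
  · have h1 := Nat.factorial_mul_pow_sub_le_factorial h
    calc n.factorial * n ^ i = n.factorial * n ^ (i - n) * n ^ n := by
          rw [mul_assoc, ← pow_add, Nat.sub_add_cancel h]
      _ ≤ _ := by gcongr

/-- A binomial distribution of integral mean has its mode there. -/
theorem choose_mul_pow_le_choose_mean {E L i : ℕ} (hL : L ≤ E) (hi : i ≤ E) :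
    E.choose i * (L ^ i * (E - L) ^ (E - i)) ≤ E.choose L * (L ^ L * (E - L) ^ (E - L)) := by
  have h1 := factorial_mul_pow_le_factorial_mul_pow_self L i
  have h2 := factorial_mul_pow_le_factorial_mul_pow_self (E - L) (E - i)
  have e1 := Nat.choose_mul_factorial_mul_factorial hL
  have e2 := Nat.choose_mul_factorial_mul_factorial hi
  have hpos : 0 < L.factorial * (E - L).factorial * (i.factorial * (E - i).factorial) := by
    positivity
  refine Nat.le_of_mul_le_mul_left ?_ hpos
  calc L.factorial * (E - L).factorial * (i.factorial * (E - i).factorial) *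
        (E.choose i * (L ^ i * (E - L) ^ (E - i)))
      = (E.choose i * i.factorial * (E - i).factorial) *
        ((L.factorial * L ^ i) * ((E - L).factorial * (E - L) ^ (E - i))) := by ring
    _ ≤ (E.choose i * i.factorial * (E - i).factorial) *
        ((i.factorial * L ^ L) * ((E - i).factorial * (E - L) ^ (E - L))) := by gcongr
    _ = (E.choose L * L.factorial * (E - L).factorial) *
        ((i.factorial * L ^ L) * ((E - i).factorial * (E - L) ^ (E - L))) := by rw [e1, e2]
    _ = _ := by ring

/-- A binomial probability is at most one. The freedom to take θ different from L/E is needed for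
the existence of the limit. -/
theorem choose_mul_pow_mul_pow_le_one {θ : ℝ} (h0 : 0 ≤ θ) (h1 : θ ≤ 1) {E L : ℕ} (hL : L ≤ E) :
    (E.choose L : ℝ) * (θ ^ L * (1 - θ) ^ (E - L)) ≤ 1 := by
  have h := add_pow θ (1 - θ) E
  rw [add_sub_cancel, one_pow] at h
  have h2 := Finset.single_le_sum (s := Finset.range (E + 1))
    (f := fun i => θ ^ i * (1 - θ) ^ (E - i) * (E.choose i : ℝ))
    (fun i _ => by have := sub_nonneg.2 h1; positivity)
    (Finset.mem_range.2 (Nat.lt_succ_of_le hL))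
  rw [mul_comm]
  exact h2.trans h.ge

/-- The E + 1 binomial probabilities with mean L sum to one, and the one at L is the largest. -/
theorem one_le_choose_mul_pow_mul_pow {E L : ℕ} (hE : 0 < E) (hL : L ≤ E) :
    1 ≤ ((E : ℝ) + 1) * ((E.choose L : ℝ) *
      (((L : ℝ) / E) ^ L * (1 - (L : ℝ) / E) ^ (E - L))) := by
  have h := add_pow L (E - L) E
  rw [Nat.add_sub_cancel' hL] at h
  have h2 : E ^ E ≤ (E + 1) * (E.choose L * (L ^ L * (E - L) ^ (E - L))) := by
    calc E ^ E = _ := h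
      _ ≤ ∑ i ∈ Finset.range (E + 1), E.choose L * (L ^ L * (E - L) ^ (E - L)) := by
        refine Finset.sum_le_sum fun i hi => ?_
        have := choose_mul_pow_le_choose_mean hL (Nat.lt_succ_iff.1 (Finset.mem_range.1 hi))
        rw [Nat.cast_id]
        linarith
      _ = _ := by simp
  have h3 : (E : ℝ) ^ E ≤ ((E : ℝ) + 1) *
      (E.choose L * ((L : ℝ) ^ L * ((E : ℝ) - L) ^ (E - L))) := by
    have h4 : ((E ^ E : ℕ) : ℝ) ≤ ((E + 1) * (E.choose L * (L ^ L * (E - L) ^ (E - L))) : ℕ) := by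
      exact_mod_cast h2
    push_cast [Nat.cast_sub hL] at h4
    exact h4
  have hE' : (0 : ℝ) < E := by exact_mod_cast hE
  have h5 : (1 - (L : ℝ) / E) = ((E : ℝ) - L) / E := by field_simp
  have h6 : (E : ℝ) ^ E = (E : ℝ) ^ L * (E : ℝ) ^ (E - L) := by
    rw [← pow_add, Nat.add_sub_cancel' hL]
  rw [h5, div_pow, div_pow, div_mul_div_comm, ← h6, ← mul_div_assoc, ← mul_div_assoc,
    le_div_iff₀ (by positivity), one_mul]
  exact h3

theorem log_choose_le {E L : ℕ} (h0 : 0 < L) (hL : L < E) :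
    Real.log (E.choose L) ≤ -(L * Real.log (L / E)) - (E - L) * Real.log (1 - L / E) := by
  have hE : (0 : ℝ) < E := by exact_mod_cast h0.trans hL
  have hL0 : (0 : ℝ) < L := by exact_mod_cast h0
  have hlt : (L : ℝ) / E < 1 := by rw [div_lt_one hE]; exact_mod_cast hL
  have hpos : (0 : ℝ) < L / E := by positivity
  have hpos' : (0 : ℝ) < 1 - L / E := by linarith
  have hc : (0 : ℝ) < E.choose L := by exact_mod_cast Nat.choose_pos hL.le
  have h := Real.log_le_log (by positivity) (choose_mul_pow_mul_pow_le_one hpos.le hlt.le hL.le)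
  rw [Real.log_mul hc.ne' (by positivity), Real.log_mul (by positivity) (by positivity),
    Real.log_pow, Real.log_pow, Real.log_one, Nat.cast_sub hL.le] at h
  linarith

theorem le_log_choose {E L : ℕ} (h0 : 0 < L) (hL : L < E) :
    -(L * Real.log (L / E)) - (E - L) * Real.log (1 - L / E) - Real.log (E + 1) ≤
      Real.log (E.choose L) := by
  have hE : (0 : ℝ) < E := by exact_mod_cast h0.trans hL
  have hL0 : (0 : ℝ) < L := by exact_mod_cast h0
  have hlt : (L : ℝ) / E < 1 := by rw [div_lt_one hE]; exact_mod_cast hL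
  have hpos : (0 : ℝ) < L / E := by positivity
  have hpos' : (0 : ℝ) < 1 - L / E := by linarith
  have hc : (0 : ℝ) < E.choose L := by exact_mod_cast Nat.choose_pos hL.le
  have h := Real.log_le_log one_pos (one_le_choose_mul_pow_mul_pow (h0.trans hL) hL.le)
  rw [Real.log_mul (by positivity) (by positivity), Real.log_mul hc.ne' (by positivity),
    Real.log_mul (by positivity) (by positivity),
    Real.log_pow, Real.log_pow, Real.log_one, Nat.cast_sub hL.le] at h
  linarith

theorem one_sub_mul_log_one_sub_ge {θ : ℝ} (h1 : θ < 1) : -θ ≤ (1 - θ) * Real.log (1 - θ) := by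
  have h : 0 < 1 - θ := by linarith
  have := Real.one_sub_inv_le_log_of_pos h
  have h2 := mul_le_mul_of_nonneg_left this h.le
  rw [mul_sub, mul_inv_cancel₀ h.ne'] at h2
  linarith

theorem one_sub_mul_log_one_sub_le {θ : ℝ} (h1 : θ < 1) :
    (1 - θ) * Real.log (1 - θ) ≤ -θ + θ ^ 2 := by
  have h : 0 < 1 - θ := by linarith
  have := mul_le_mul_of_nonneg_left (Real.log_le_sub_one_of_pos h) h.le
  linarith

end Binomial

/-! ### Ensemble parameters and admissible block lengths -/

namespace GLDPCEnsemble

variable (M : GLDPCEnsemble)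

theorem q_pos (t : Fin M.nv) : 0 < M.q t := lt_of_lt_of_le two_pos (M.two_le_q t)

instance : Nonempty (Fin M.nc) := by
  by_contra h
  rw [not_nonempty_iff] at h
  have := M.rho_sum
  simp at this

instance : Nonempty (Fin M.nv) := by
  by_contra h
  rw [not_nonempty_iff] at h
  have := M.lam_sum
  simp at this

theorem intLam_eq : M.intLam = ∑ t, (M.lam t : ℝ) / M.q t := by
  unfold intLam
  rw [intervalIntegral.integral_finsetSum
    fun t _ => Continuous.intervalIntegrable (by fun_prop) _ _]
  refine Finset.sum_congr rfl fun t _ => ?_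
  have h := M.q_pos t
  rw [intervalIntegral.integral_const_mul, integral_pow]
  have h2 : ((M.q t - 1 : ℕ) : ℝ) + 1 = M.q t := by
    rw [Nat.cast_sub h]; push_cast; ring
  rw [h2, Nat.sub_add_cancel h, one_pow, zero_pow h.ne', sub_zero, mul_one_div]

theorem intLam_pos : 0 < M.intLam := by
  rw [intLam_eq]
  refine Finset.sum_pos (fun t _ => ?_) Finset.univ_nonempty
  have h1 : (0 : ℝ) < M.lam t := by exact_mod_cast M.lam_pos t
  have h2 : (0 : ℝ) < M.q t := by exact_mod_cast M.q_pos t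
  positivity

theorem exists_weight_eq_minDist (t : Fin M.nc) :
    ∃ c ∈ M.code t, c ≠ 0 ∧ hammingNorm c = M.minDist t := by
  have h : {w | ∃ c ∈ M.code t, c ≠ 0 ∧ hammingNorm c = w}.Nonempty := by
    obtain ⟨c, hc, hc0⟩ := (Submodule.ne_bot_iff _).1 (M.code_ne_bot t)
    exact ⟨_, c, hc, hc0, rfl⟩
  exact Nat.sInf_mem h

theorem minDist_le_hammingNorm {t : Fin M.nc} {c : Fin (M.s t) → ZMod 2} (hc : c ∈ M.code t)
    (h0 : c ≠ 0) : M.minDist t ≤ hammingNorm c :=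
  Nat.sInf_le ⟨c, hc, h0, rfl⟩

theorem r_le_minDist (t : Fin M.nc) : M.r ≤ M.minDist t := ciInf_le' _ t

theorem exists_minDist_eq_r : ∃ t, M.minDist t = M.r :=
  (ciInf_mem (f := M.minDist))

theorem two_le_r : 2 ≤ M.r := by
  obtain ⟨t, ht⟩ := M.exists_minDist_eq_r
  obtain ⟨c, hc, h0, hw⟩ := M.exists_weight_eq_minDist t
  rw [← ht, ← hw]
  exact M.two_le_weight t c hc h0

theorem p_le_q (t : Fin M.nv) : M.p ≤ M.q t := ciInf_le' _ t

theorem exists_q_eq_p : ∃ t, M.q t = M.p := ciInf_mem (f := M.q)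

theorem two_le_p : 2 ≤ M.p := by
  obtain ⟨t, ht⟩ := M.exists_q_eq_p
  exact ht ▸ M.two_le_q t

theorem s_pos (t : Fin M.nc) : 0 < M.s t := by
  obtain ⟨c, hc, h0⟩ := (Submodule.ne_bot_iff _).1 (M.code_ne_bot t)
  by_contra h
  have : IsEmpty (Fin (M.s t)) := by
    rw [Nat.eq_zero_of_not_pos h]; infer_instance
  exact h0 (Subsingleton.elim _ _)

theorem A_eq_card (t : Fin M.nc) (u : ℕ) :
    M.A t u = Nat.card {c : M.code t // M.cnWeight t c = u} := by
  unfold A cnWeight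
  exact Nat.card_congr
    { toFun := fun c => ⟨⟨c.1, c.2.1⟩, c.2.2⟩
      invFun := fun c => ⟨c.1.1, c.1.2, c.2⟩
      left_inv := fun _ => rfl
      right_inv := fun _ => rfl }

theorem A_minDist_pos (t : Fin M.nc) : 0 < M.A t (M.minDist t) := by
  obtain ⟨c, hc, h0, hw⟩ := M.exists_weight_eq_minDist t
  unfold A
  rw [Nat.card_pos_iff]
  exact ⟨⟨⟨c, hc, hw⟩⟩, inferInstance⟩

variable {M}

section Admissible

variable {n : ℕ} (hn : M.Admissible n)
include hn

theorem Admissible.numCN_eq (t : Fin M.nc) :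
    (M.numCN n t : ℝ) = n * (M.rho t / (M.intLam * M.s t)) := by
  have := M.intLam_pos.ne'
  have h2 : (M.s t : ℝ) ≠ 0 := by exact_mod_cast (M.s_pos t).ne'
  rw [hn.2.1 t, edges]
  field_simp

theorem Admissible.numVN_eq (t : Fin M.nv) : (M.numVN n t : ℝ) = n * M.delta t := by
  have := M.intLam_pos.ne'
  have h2 : (M.q t : ℝ) ≠ 0 := by exact_mod_cast (M.q_pos t).ne'
  rw [hn.2.2 t, edges, delta]
  field_simp

theorem Admissible.numEdges_eq : (M.numEdges n : ℝ) = n / M.intLam := by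
  have h1 : ∀ t, (M.numVN n t : ℝ) * M.q t = n / M.intLam * M.lam t := by
    intro t
    have h2 : (M.q t : ℝ) ≠ 0 := by exact_mod_cast (M.q_pos t).ne'
    rw [hn.2.2 t, edges]
    field_simp
  have h3 : (∑ t, (M.lam t : ℝ)) = 1 := by exact_mod_cast M.lam_sum
  rw [numEdges]
  push_cast
  rw [Finset.sum_congr rfl fun t _ => h1 t, ← Finset.mul_sum, h3, mul_one]

theorem Admissible.card_cSocket : Fintype.card (M.CSocket n) = M.numEdges n := by
  have h1 : ∀ t, (M.numCN n t : ℝ) * M.s t = n / M.intLam * M.rho t := by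
    intro t
    have h2 : (M.s t : ℝ) ≠ 0 := by exact_mod_cast (M.s_pos t).ne'
    rw [hn.2.1 t, edges]
    field_simp
  have h3 : (∑ t, (M.rho t : ℝ)) = 1 := by exact_mod_cast M.rho_sum
  have h4 : (Fintype.card (M.CSocket n) : ℝ) = M.numEdges n := by
    rw [hn.numEdges_eq]
    simp only [Fintype.card_sigma, Fintype.card_prod, Fintype.card_fin]
    push_cast
    rw [Finset.sum_congr rfl fun t _ => h1 t, ← Finset.mul_sum, h3, mul_one]
  exact_mod_cast h4

theorem Admissible.numEdges_pos : 0 < M.numEdges n := by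
  have h := hn.numEdges_eq
  have h1 : (0 : ℝ) < n / M.intLam := by
    have := M.intLam_pos
    have h2 : (0 : ℝ) < n := by exact_mod_cast hn.1
    positivity
  rw [← h] at h1
  exact_mod_cast h1

theorem Admissible.expectedNum_eq (w : ℕ) :
    M.expectedNum n w = ∑ L ∈ Finset.range (M.numEdges n + 1),
      (M.vnCount (M.numVN n) w L : ℝ) * M.cnCount (M.numCN n) L / (M.numEdges n).choose L :=
  expectedNum_eq_sum hn.card_cSocket w

theorem Admissible.numVN_add_mul {m k : ℕ} (hm : M.Admissible m) (h : M.Admissible (k * n + m)) :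
    M.numVN (k * n + m) = k • M.numVN n + M.numVN m := by
  funext t
  have : (M.numVN (k * n + m) t : ℝ) = ((k • M.numVN n + M.numVN m) t : ℕ) := by
    simp only [Pi.add_apply, Pi.smul_apply, smul_eq_mul]
    push_cast
    rw [h.numVN_eq, hn.numVN_eq, hm.numVN_eq]
    push_cast
    ring
  exact_mod_cast this

theorem Admissible.numCN_add_mul {m k : ℕ} (hm : M.Admissible m) (h : M.Admissible (k * n + m)) :
    M.numCN (k * n + m) = k • M.numCN n + M.numCN m := by
  funext t
  have : (M.numCN (k * n + m) t : ℝ) = ((k • M.numCN n + M.numCN m) t : ℕ) := by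
    simp only [Pi.add_apply, Pi.smul_apply, smul_eq_mul]
    push_cast
    rw [h.numCN_eq, hn.numCN_eq, hm.numCN_eq]
    push_cast
    ring
  exact_mod_cast this

theorem Admissible.numEdges_add_mul {m k : ℕ} (hm : M.Admissible m)
    (h : M.Admissible (k * n + m)) :
    M.numEdges (k * n + m) = k * M.numEdges n + M.numEdges m := by
  have : (M.numEdges (k * n + m) : ℝ) = (k * M.numEdges n + M.numEdges m : ℕ) := by
    push_cast
    rw [h.numEdges_eq, hn.numEdges_eq, hm.numEdges_eq]
    push_cast
    ring
  exact_mod_cast this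

end Admissible

/-- Each variable node set to one uses at least p edges and at most the maximal degree, for which
the sum of all degrees is a convenient bound. -/
theorem mem_range_of_vnCount_pos {m : Fin M.nv → ℕ} {w L : ℕ} (h : 0 < M.vnCount m w L) :
    M.p * w ≤ L ∧ L ≤ (∑ t, M.q t) * w := by
  unfold vnCount configCount at h
  rw [Nat.card_pos_iff] at h
  obtain ⟨⟨ω, hω⟩⟩ := h.1
  have h1 : ∑ t, ∑ a, (M.vnWeight t (ω t a)).1 = w := by
    have := congrArg Prod.fst hω
    simpa [Prod.fst_sum] using this
  have h2 : ∑ t, ∑ a, (M.vnWeight t (ω t a)).2 = L := by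
    have := congrArg Prod.snd hω
    simpa [Prod.snd_sum] using this
  constructor
  · rw [← h1, ← h2, Finset.mul_sum]
    refine Finset.sum_le_sum fun t _ => ?_
    rw [Finset.mul_sum]
    refine Finset.sum_le_sum fun a _ => ?_
    unfold vnWeight
    split_ifs
    · simp
    · simpa using M.p_le_q t
  · rw [← h1, ← h2, Finset.mul_sum]
    refine Finset.sum_le_sum fun t _ => ?_
    rw [Finset.mul_sum]
    refine Finset.sum_le_sum fun a _ => ?_
    unfold vnWeight
    split_ifs
    · simp
    · simpa using Finset.single_le_sum (fun t _ => Nat.zero_le (M.q t)) (Finset.mem_univ t)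

end GLDPCEnsemble

/-! ### Existence of the growth rate -/

/-- A form of Fekete's lemma: superadditivity up to an error of size `o(n)`, along multiples of a
fixed index. -/
theorem exists_tendsto_of_almost_superadditive {S : Set ℕ} (hS : S.Nonempty) {g e : ℕ → ℝ} {B : ℝ}
    (hpos : ∀ n ∈ S, 0 < n) (hB : ∀ n ∈ S, g n ≤ B * n) (he0 : ∀ n, 0 ≤ e n)
    (he : Tendsto (fun n : ℕ => e n / n) atTop (𝓝 0))
    (h : ∀ n₀ ∈ S, ∀ m ∈ S, ∃ c : ℝ, ∀ k : ℕ, k * n₀ + m ∈ S →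
      k * (g n₀ - e n₀) - c ≤ g (k * n₀ + m)) :
    ∃ l, Tendsto (fun n : ℕ => g n / n) (atTop ⊓ 𝓟 S) (𝓝 l) := by
  -- As in Fekete's lemma, the limit is a supremum, here that of the values lowered by the error.
  set V : Set ℝ := (fun n : ℕ => (g n - e n) / n) '' S with hV
  have hVne : V.Nonempty := hS.image _
  have hVb : BddAbove V := by
    refine ⟨B, ?_⟩
    rintro _ ⟨n, hn, rfl⟩
    have h1 : (0 : ℝ) < n := by exact_mod_cast hpos n hn
    simp only
    rw [div_le_iff₀ h1]
    linarith [hB n hn, he0 n]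
  have hlow : ∀ n₀ ∈ S, ∀ δ > 0, ∀ᶠ n in atTop ⊓ 𝓟 S, (g n₀ - e n₀) / n₀ - δ < g n / n := by
    intro n₀ hn₀ δ hδ
    have hn₀' : (0 : ℝ) < n₀ := by exact_mod_cast hpos n₀ hn₀
    set a := g n₀ - e n₀
    -- In each residue class modulo n₀ that meets `S`, fix a representative m; every later n of the
    -- class is k n₀ + m, and the constant belonging to m vanishes after division by n.
    have hres : ∀ i ∈ Finset.range n₀, ∀ᶠ n in (atTop : Filter ℕ), n ∈ S → n % n₀ = i →
        a / n₀ - δ < g n / n := by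
      intro i _
      by_cases hex : ∃ m ∈ S, m % n₀ = i
      · obtain ⟨m, hm, hmi⟩ := hex
        obtain ⟨c, hc⟩ := h n₀ hn₀ m hm
        have hlim : Tendsto (fun n : ℕ => (m * a / n₀ + c) / (n : ℝ)) atTop (𝓝 0) :=
          tendsto_const_div_atTop_nhds_zero_nat _
        filter_upwards [hlim.eventually (gt_mem_nhds hδ), eventually_ge_atTop m] with n hlt hnm hn hni
        have hn' : (0 : ℝ) < n := by exact_mod_cast hpos n hn
        have hmod : n₀ ∣ n - m := (Nat.modEq_iff_dvd' hnm).1 (hmi.trans hni.symm)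
        obtain ⟨k, hk⟩ := hmod
        have hnk : n = k * n₀ + m := by rw [mul_comm k]; omega
        have hck := hc k (hnk ▸ hn)
        rw [← hnk] at hck
        have hkr : (n : ℝ) = k * n₀ + m := by exact_mod_cast hnk
        rw [div_lt_iff₀ hn'] at hlt
        rw [lt_div_iff₀ hn']
        have hka : (k : ℝ) * a = n * (a / n₀) - m * a / n₀ := by
          rw [hkr]; field_simp; ring
        linarith
      · exact Eventually.of_forall fun n hn hni => absurd ⟨n, hn, hni⟩ hex
    rw [eventually_inf_principal]
    filter_upwards [(Filter.eventually_all_finset _).2 hres] with n hn hnS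
    exact hn (n % n₀) (Finset.mem_range.2 (Nat.mod_lt _ (hpos n₀ hn₀))) hnS rfl
  refine ⟨sSup V, tendsto_order.2 ⟨fun x hx => ?_, fun x hx => ?_⟩⟩
  · obtain ⟨_, ⟨n₀, hn₀, rfl⟩, hlt⟩ := exists_lt_of_lt_csSup hVne hx
    filter_upwards [hlow n₀ hn₀ _ (sub_pos.2 hlt)] with n hn
    linarith
  · have h1 := he.eventually (gt_mem_nhds (sub_pos.2 hx))
    rw [eventually_inf_principal]
    filter_upwards [h1] with n hn hnS
    have h2 : (g n - e n) / n ≤ sSup V := le_csSup hVb ⟨n, hnS, rfl⟩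
    rw [sub_div] at h2
    linarith

theorem tendsto_log_mul_add_one_div (c : ℝ) (hc : 0 < c) :
    Tendsto (fun n : ℕ => Real.log (n / c + 1) / n) atTop (𝓝 0) := by
  have h1 : Tendsto (fun x : ℝ => Real.log x / x) atTop (𝓝 0) :=
    Real.isLittleO_log_id_atTop.tendsto_div_nhds_zero
  have h2 : Tendsto (fun n : ℕ => (n : ℝ) / c + 1) atTop atTop :=
    tendsto_atTop_add_const_right _ _ (tendsto_natCast_atTop_atTop.atTop_div_const hc)
  have h3 := h1.comp h2
  have h4 : Tendsto (fun n : ℕ => 1 / c + 1 / (n : ℝ)) atTop (𝓝 (1 / c + 0)) :=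
    tendsto_const_nhds.add tendsto_one_div_atTop_nhds_zero_nat
  have h5 := h3.mul h4
  rw [zero_mul] at h5
  refine h5.congr' ?_
  filter_upwards [eventually_gt_atTop 0] with n hn
  have hn' : (0 : ℝ) < n := by exact_mod_cast hn
  have h6 : (n : ℝ) / c + 1 ≠ 0 := by positivity
  simp only [Function.comp]
  field_simp

namespace GLDPCEnsemble

variable {M : GLDPCEnsemble}

/-- There are no more variable nodes than edges. This crude bound keeps the supremum in the Fekete
argument finite. -/
theorem expectedNum_le_two_pow (n w : ℕ) : M.expectedNum n w ≤ 2 ^ M.numEdges n := by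
  classical
  unfold expectedNum
  refine div_le_of_le_mul₀ (by positivity) (by positivity) ?_
  have h : ∀ π : M.Graph n, (M.numCodewords π w : ℝ) ≤ 2 ^ M.numEdges n := by
    intro π
    have h1 : M.numCodewords π w ≤ Nat.card (M.VNode n → ZMod 2) :=
      Nat.card_le_card_of_injective _ Subtype.val_injective
    have h2 : Nat.card (M.VNode n → ZMod 2) = 2 ^ ∑ t, M.numVN n t := by simp
    have h3 : ∑ t, M.numVN n t ≤ M.numEdges n :=
      Finset.sum_le_sum fun t _ => Nat.le_mul_of_pos_right _ (M.q_pos t)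
    have h4 : M.numCodewords π w ≤ 2 ^ M.numEdges n :=
      (h1.trans h2.le).trans (Nat.pow_le_pow_right two_pos h3)
    exact_mod_cast h4
  refine (Finset.sum_le_card_nsmul _ _ _ fun π _ => h π).trans ?_
  rw [nsmul_eq_mul, mul_comm]
  rfl

/-- Almost supermultiplicativity of the expected number of codewords. -/
theorem exists_mul_pow_le_expectedNum {n₀ m w₀ w : ℕ} (hn₀ : M.Admissible n₀)
    (hm : M.Admissible m) (h₀ : 0 < M.expectedNum n₀ w₀) (h : 0 < M.expectedNum m w)
    (hw₀ : 0 < w₀) (hsmall : (∑ t, M.q t) * w₀ < M.numEdges n₀) :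
    ∃ d > 0, ∀ k : ℕ, M.Admissible (k * n₀ + m) →
      d * (M.expectedNum n₀ w₀ / ((M.numEdges n₀ : ℝ) + 1) ^ 2) ^ k ≤
        M.expectedNum (k * n₀ + m) (k * w₀ + w) := by
  set E₀ := M.numEdges n₀ with hE₀
  set T₀ : ℕ → ℝ := fun L => (M.vnCount (M.numVN n₀) w₀ L : ℝ) * M.cnCount (M.numCN n₀) L /
    E₀.choose L with hT₀
  have hf₀ : M.expectedNum n₀ w₀ = ∑ L ∈ Finset.range (E₀ + 1), T₀ L := hn₀.expectedNum_eq w₀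
  -- The largest of the E₀ + 1 summands carries the sum up to that factor, so only one edge weight
  -- has to be replicated k times.
  obtain ⟨L₀, hL₀, hmax⟩ := Finset.exists_max_image (Finset.range (E₀ + 1)) T₀ ⟨0, by simp⟩
  have hle : M.expectedNum n₀ w₀ ≤ ((E₀ : ℝ) + 1) * T₀ L₀ := by
    rw [hf₀]
    refine (Finset.sum_le_card_nsmul _ _ _ hmax).trans ?_
    rw [Finset.card_range, nsmul_eq_mul]
    push_cast
    rfl
  have hT₀pos : 0 < T₀ L₀ := by
    by_contra hneg
    have : ((E₀ : ℝ) + 1) * T₀ L₀ ≤ 0 :=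
      mul_nonpos_of_nonneg_of_nonpos (by positivity) (not_lt.1 hneg)
    linarith
  have hL₀' : L₀ ≤ E₀ := Nat.lt_succ_iff.1 (Finset.mem_range.1 hL₀)
  have hv₀ : 0 < M.vnCount (M.numVN n₀) w₀ L₀ := by
    rw [Nat.pos_iff_ne_zero]
    intro h0
    simp [hT₀, h0] at hT₀pos
  obtain ⟨hpL, hLq⟩ := mem_range_of_vnCount_pos hv₀
  have hL₀pos : 0 < L₀ := lt_of_lt_of_le (Nat.mul_pos (by have := M.two_le_p; omega) hw₀) hpL
  have hL₀lt : L₀ < E₀ := hLq.trans_lt hsmall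
  rw [hm.expectedNum_eq] at h
  obtain ⟨l, hl, hlpos⟩ := Finset.exists_lt_of_sum_lt (s := Finset.range (M.numEdges m + 1))
    (f := fun _ => (0 : ℝ)) (by simpa using h)
  have hl' : l ≤ M.numEdges m := Nat.lt_succ_iff.1 (Finset.mem_range.1 hl)
  have hvm : 1 ≤ M.vnCount (M.numVN m) w l := by
    rw [Nat.one_le_iff_ne_zero]
    intro h0
    simp [h0] at hlpos
  have ham : 1 ≤ M.cnCount (M.numCN m) l := by
    rw [Nat.one_le_iff_ne_zero]
    intro h0
    simp [h0] at hlpos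
  have hE₀pos : (0 : ℝ) < E₀ := by exact_mod_cast hn₀.numEdges_pos
  -- The same θ serves for every k. It lies strictly between 0 and 1 because 0 < L₀ < E₀, so the
  -- constant d produced below is positive.
  set θ : ℝ := (L₀ : ℝ) / E₀ with hθ
  have hθpos : 0 < θ := div_pos (by exact_mod_cast hL₀pos) hE₀pos
  have hθlt : θ < 1 := (div_lt_one hE₀pos).2 (by exact_mod_cast hL₀lt)
  have hθ' : 0 < 1 - θ := sub_pos.2 hθlt
  set b : ℝ := θ ^ L₀ * (1 - θ) ^ (E₀ - L₀) with hb
  have hbpos : 0 < b := by positivity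
  refine ⟨θ ^ l * (1 - θ) ^ (M.numEdges m - l), by positivity, fun k hk => ?_⟩
  have hE := hn₀.numEdges_add_mul hm hk
  rw [← hE₀] at hE
  have hLE : k * L₀ + l ≤ M.numEdges (k * n₀ + m) := by
    rw [hE]; gcongr
  have hterm : (M.vnCount (M.numVN (k * n₀ + m)) (k * w₀ + w) (k * L₀ + l) : ℝ) *
      M.cnCount (M.numCN (k * n₀ + m)) (k * L₀ + l) /
        (M.numEdges (k * n₀ + m)).choose (k * L₀ + l) ≤
      M.expectedNum (k * n₀ + m) (k * w₀ + w) := by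
    rw [hk.expectedNum_eq]
    exact Finset.single_le_sum (f := fun L =>
      (M.vnCount (M.numVN (k * n₀ + m)) (k * w₀ + w) L : ℝ) *
        M.cnCount (M.numCN (k * n₀ + m)) L / (M.numEdges (k * n₀ + m)).choose L)
      (fun _ _ => by positivity) (Finset.mem_range.2 (Nat.lt_succ_of_le hLE))
  refine le_trans ?_ hterm
  have hv : (M.vnCount (M.numVN n₀) w₀ L₀ : ℝ) ^ k ≤
      M.vnCount (M.numVN (k * n₀ + m)) (k * w₀ + w) (k * L₀ + l) := by
    have := configCount_pow_mul_le M.vnWeight k (M.numVN n₀) (M.numVN m) (w₀, L₀) (w, l)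
    rw [← hn₀.numVN_add_mul hm hk] at this
    have h2 := (Nat.le_mul_of_pos_right (M.vnCount (M.numVN n₀) w₀ L₀ ^ k) hvm).trans this
    exact_mod_cast h2
  have ha : (M.cnCount (M.numCN n₀) L₀ : ℝ) ^ k ≤
      M.cnCount (M.numCN (k * n₀ + m)) (k * L₀ + l) := by
    have := configCount_pow_mul_le M.cnWeight k (M.numCN n₀) (M.numCN m) L₀ l
    rw [← hn₀.numCN_add_mul hm hk] at this
    have h2 := (Nat.le_mul_of_pos_right (M.cnCount (M.numCN n₀) L₀ ^ k) ham).trans this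
    exact_mod_cast h2
  have hcpos : (0 : ℝ) < (M.numEdges (k * n₀ + m)).choose (k * L₀ + l) := by
    exact_mod_cast Nat.choose_pos hLE
  -- The binomial bound at this fixed θ factors over the k copies and the remainder.
  have hc : b ^ k * (θ ^ l * (1 - θ) ^ (M.numEdges m - l)) ≤
      1 / (M.numEdges (k * n₀ + m)).choose (k * L₀ + l) := by
    rw [le_div_iff₀ hcpos, mul_comm]
    refine le_trans (le_of_eq ?_) (choose_mul_pow_mul_pow_le_one hθpos.le hθlt.le hLE)
    congr 1
    have hsub : M.numEdges (k * n₀ + m) - (k * L₀ + l) = k * (E₀ - L₀) + (M.numEdges m - l) := by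
      rw [hE, Nat.mul_sub]
      have := Nat.mul_le_mul_left k hL₀'
      omega
    rw [hsub, hb, mul_pow, ← pow_mul, ← pow_mul, pow_add, pow_add, mul_comm L₀, mul_comm (E₀ - L₀)]
    ring
  have hc₀pos : (0 : ℝ) < E₀.choose L₀ := by exact_mod_cast Nat.choose_pos hL₀'
  -- One factor E₀ + 1 is lost in passing to the largest summand, the other in replacing
  -- 1/binom(E₀,L₀) by `b`.
  have hbase : M.expectedNum n₀ w₀ / ((E₀ : ℝ) + 1) ^ 2 ≤
      M.vnCount (M.numVN n₀) w₀ L₀ * M.cnCount (M.numCN n₀) L₀ * b := by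
    have h1 := one_le_choose_mul_pow_mul_pow hn₀.numEdges_pos hL₀'
    have h2 : T₀ L₀ ≤ ((E₀ : ℝ) + 1) *
        (M.vnCount (M.numVN n₀) w₀ L₀ * M.cnCount (M.numCN n₀) L₀ * b) := by
      simp only [hT₀]
      rw [div_le_iff₀ hc₀pos]
      have h3 := mul_le_mul_of_nonneg_left h1 (show (0 : ℝ) ≤
        M.vnCount (M.numVN n₀) w₀ L₀ * M.cnCount (M.numCN n₀) L₀ by positivity)
      rw [mul_one] at h3
      refine h3.trans (le_of_eq ?_)
      rw [hb, hθ, hE₀]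
      ring
    rw [div_le_iff₀ (by positivity)]
    calc M.expectedNum n₀ w₀ ≤ ((E₀ : ℝ) + 1) * T₀ L₀ := hle
      _ ≤ ((E₀ : ℝ) + 1) * (((E₀ : ℝ) + 1) *
        (M.vnCount (M.numVN n₀) w₀ L₀ * M.cnCount (M.numCN n₀) L₀ * b)) := by gcongr
      _ = _ := by ring
  calc θ ^ l * (1 - θ) ^ (M.numEdges m - l) * (M.expectedNum n₀ w₀ / ((E₀ : ℝ) + 1) ^ 2) ^ k
      ≤ θ ^ l * (1 - θ) ^ (M.numEdges m - l) *
        (M.vnCount (M.numVN n₀) w₀ L₀ * M.cnCount (M.numCN n₀) L₀ * b) ^ k := by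
        gcongr
    _ = (M.vnCount (M.numVN n₀) w₀ L₀ : ℝ) ^ k * (M.cnCount (M.numCN n₀) L₀ : ℝ) ^ k *
        (b ^ k * (θ ^ l * (1 - θ) ^ (M.numEdges m - l))) := by ring
    _ ≤ M.vnCount (M.numVN (k * n₀ + m)) (k * w₀ + w) (k * L₀ + l) *
        M.cnCount (M.numCN (k * n₀ + m)) (k * L₀ + l) *
        (1 / (M.numEdges (k * n₀ + m)).choose (k * L₀ + l)) := by gcongr
    _ = _ := by rw [mul_one_div]

/-- The block lengths that qualify for the limit defining the growth rate. -/
def qualifying (M : GLDPCEnsemble) (α : ℝ) : Set ℕ :=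
  {n | M.Admissible n ∧ ∃ w : ℕ, (w : ℝ) = α * n ∧ 0 < M.expectedNum n w}

/-- Fekete applies with error 2 log(E + 1), the logarithm of the factor lost per copy. The smallness
of α keeps the number of edges carrying a one strictly below E. -/
theorem exists_tendsto_normalizedLog {α : ℝ} (hα : 0 < α)
    (hsmall : (∑ t, (M.q t : ℝ)) * M.intLam * α < 1) (hne : (M.qualifying α).Nonempty) :
    ∃ l, Tendsto (M.normalizedLog α) (M.growthFilter α) (𝓝 l) := by
  have hI := M.intLam_pos
  have hfloor : ∀ {n w : ℕ}, (w : ℝ) = α * n → ⌊α * n⌋₊ = w := by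
    intro n w h
    rw [← h, Nat.floor_natCast]
  suffices hex : ∃ l, Tendsto (fun n : ℕ => Real.log (M.expectedNum n ⌊α * n⌋₊) / n)
      (atTop ⊓ 𝓟 (M.qualifying α)) (𝓝 l) by
    obtain ⟨l, hl⟩ := hex
    refine ⟨l, hl.congr fun n => ?_⟩
    rw [normalizedLog, one_div, inv_mul_eq_div]
  refine exists_tendsto_of_almost_superadditive
    (g := fun n => Real.log (M.expectedNum n ⌊α * n⌋₊))
    (e := fun n => 2 * Real.log (n / M.intLam + 1)) (B := Real.log 2 / M.intLam)
    hne (fun n hn => hn.1.1) ?_ ?_ ?_ ?_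
  · rintro n ⟨hn, w, hw, hpos⟩
    rw [hfloor hw]
    refine (Real.log_le_log hpos (expectedNum_le_two_pow n w)).trans (le_of_eq ?_)
    rw [Real.log_pow, hn.numEdges_eq]
    ring
  · intro n
    have : 0 ≤ Real.log (n / M.intLam + 1) :=
      Real.log_nonneg (by have : 0 ≤ (n : ℝ) / M.intLam := by positivity
                          linarith)
    positivity
  · have := (tendsto_log_mul_add_one_div M.intLam hI).const_mul 2
    rw [mul_zero] at this
    exact this.congr fun n => by ring
  · rintro n₀ ⟨hn₀, w₀, hw₀, hpos₀⟩ m ⟨hm, w, hw, hpos⟩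
    have hn₀' : (0 : ℝ) < n₀ := by exact_mod_cast hn₀.1
    have hw₀pos : 0 < w₀ := by
      have : (0 : ℝ) < w₀ := by rw [hw₀]; positivity
      exact_mod_cast this
    have hs : (∑ t, M.q t) * w₀ < M.numEdges n₀ := by
      have : (((∑ t, M.q t) * w₀ : ℕ) : ℝ) < M.numEdges n₀ := by
        push_cast
        rw [hw₀, hn₀.numEdges_eq, lt_div_iff₀ hI]
        nlinarith
      exact_mod_cast this
    obtain ⟨d, hd, hk⟩ := exists_mul_pow_le_expectedNum hn₀ hm hpos₀ hpos hw₀pos hs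
    refine ⟨-Real.log d, fun k hkS => ?_⟩
    obtain ⟨hadm, w', hw', -⟩ := hkS
    have hw'' : w' = k * w₀ + w := by
      have : (w' : ℝ) = (k * w₀ + w : ℕ) := by
        push_cast at hw' ⊢
        rw [hw', hw₀, hw]; ring
      exact_mod_cast this
    have h1 := hk k hadm
    simp only [hfloor hw₀]
    rw [hfloor hw', hw'']
    have hbase : 0 < M.expectedNum n₀ w₀ / ((M.numEdges n₀ : ℝ) + 1) ^ 2 :=
      div_pos hpos₀ (by positivity)
    have h2 := Real.log_le_log (by positivity) h1
    rw [Real.log_mul hd.ne' (by positivity), Real.log_pow, Real.log_div hpos₀.ne' (by positivity),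
      Real.log_pow, hn₀.numEdges_eq] at h2
    push_cast at h2
    linarith

end GLDPCEnsemble

/-! ### The saddle point upper bound -/

/-- Below B, each ratio binom(E,j)/binom(E,j+1) = (j+1)/(E-j) is at most B/(E-B) ≤ κ. -/
theorem choose_le_pow_mul_choose {E B : ℕ} {κ : ℝ} (hκ : 0 ≤ κ) (hB : B ≤ E)
    (h : (B : ℝ) ≤ κ * (E - B)) {i L : ℕ} (hiL : i ≤ L) (hL : L ≤ B) :
    (E.choose i : ℝ) ≤ κ ^ (L - i) * E.choose L := by
  induction L, hiL using Nat.le_induction with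
  | base => simp
  | succ j hij ih =>
    have h1 := ih (by omega)
    have hjB : ((j : ℝ) + 1) ≤ B := by exact_mod_cast hL
    have hBE : (B : ℝ) ≤ E := by exact_mod_cast hB
    have hjE : (0 : ℝ) < E - j := by linarith
    have h2 : (E.choose (j + 1) : ℝ) * (j + 1) = E.choose j * (E - j) := by
      have := Nat.choose_succ_right_eq E j
      rw [← Nat.cast_sub (by omega)]
      exact_mod_cast this
    have h3 : ((j : ℝ) + 1) ≤ κ * (E - j) := by nlinarith
    have h4 : (E.choose j : ℝ) ≤ κ * E.choose (j + 1) := by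
      refine le_of_mul_le_mul_right ?_ hjE
      rw [← h2]
      nlinarith [(Nat.cast_nonneg (E.choose (j + 1)) : (0 : ℝ) ≤ _)]
    rw [Nat.sub_add_comm hij, pow_succ]
    calc (E.choose i : ℝ) ≤ κ ^ (j - i) * E.choose j := h1
      _ ≤ κ ^ (j - i) * (κ * E.choose (j + 1)) := by gcongr
      _ = _ := by ring

/-- One summand of the formula, compared with the minimal edge weight i = p w: the generating
function bound on `a` and the binomial ratio together leave the weight (κ/z)^(L-i) on `v`. -/
theorem saddle_term_le {v a c c' P κ z : ℝ} {i L : ℕ} (hκ : 0 < κ) (hz : 0 < z) (hv : 0 ≤ v)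
    (ha : 0 ≤ a) (hc : 0 < c) (hiL : i ≤ L) (hc' : c' ≤ κ ^ (L - i) * c) (haP : a * z ^ L ≤ P) :
    v * a / c * (c' * z ^ i) ≤ P * (v * ((κ / z) ^ L / (κ / z) ^ i)) := by
  have h : a ≤ P / z ^ L := (le_div_iff₀ (by positivity)).2 haP
  calc v * a / c * (c' * z ^ i) ≤ v * a / c * ((κ ^ (L - i) * c) * z ^ i) := by gcongr
    _ = v * κ ^ (L - i) * z ^ i * a := by field_simp
    _ ≤ v * κ ^ (L - i) * z ^ i * (P / z ^ L) := by gcongr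
    _ = P * (v * ((κ / z) ^ L / (κ / z) ^ i)) := by
      rw [pow_sub₀ _ hκ.ne' hiL, div_pow, div_pow]
      field_simp

namespace GLDPCEnsemble

variable {M : GLDPCEnsemble}

theorem cnCount_mul_pow_le (m : Fin M.nc → ℕ) (L : ℕ) {z : ℝ} (hz : 0 ≤ z) :
    M.cnCount m L * z ^ L ≤ ∏ t, (∑ c : M.code t, z ^ hammingNorm c.1) ^ m t :=
  configCount_mul_char_le M.cnWeight (fun L => z ^ L) (pow_zero z) (fun a b => pow_add z a b)
    (fun a => pow_nonneg hz a) m L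

/-- The generating function is evaluated at (x/y^p, y). This makes p edges per one free of charge,
so that only the excess degree is weighted by y. -/
theorem sum_vnCount_mul_le (m : Fin M.nv → ℕ) (w : ℕ) (s : Finset ℕ) {x y : ℝ} (hx : 0 ≤ x)
    (hy : 0 < y) :
    (∑ L ∈ s, M.vnCount m w L * (y ^ L / y ^ (M.p * w))) * x ^ w ≤
      ∏ t, (1 + x * y ^ (M.q t - M.p)) ^ m t := by
  have h := sum_configCount_mul M.vnWeight (fun g => (x / y ^ M.p) ^ g.1 * y ^ g.2) (by simp)
    (fun a b => by simp only [Prod.fst_add, Prod.snd_add, pow_add]; ring)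
    (fun a => by positivity) m ({w} ×ˢ s)
  rw [Finset.sum_product, Finset.sum_singleton] at h
  have h1 : ∀ t, ∑ o, (x / y ^ M.p) ^ (M.vnWeight t o).1 * y ^ (M.vnWeight t o).2 =
      1 + x * y ^ (M.q t - M.p) := by
    intro t
    have huniv : (Finset.univ : Finset (ZMod 2)) = {0, 1} := by decide
    rw [huniv, Finset.sum_pair (by decide)]
    simp only [vnWeight, if_true, Prod.fst_zero, Prod.snd_zero, pow_zero, one_ne_zero, if_false,
      pow_one, mul_one]
    rw [pow_sub₀ _ hy.ne' (M.p_le_q t)]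
    ring
  rw [Finset.prod_congr rfl fun t _ => by rw [h1 t]] at h
  refine le_trans (le_of_eq ?_) h
  rw [Finset.sum_mul]
  refine Finset.sum_congr rfl fun L _ => ?_
  simp only [vnCount]
  rw [div_pow, ← pow_mul]
  ring

/-- A saddle point bound for the expected number of codewords. -/
theorem Admissible.expectedNum_mul_le {n w : ℕ} (hn : M.Admissible n) {κ x z : ℝ} (hκ : 0 < κ)
    (hx : 0 < x) (hz : 0 < z) (hB : (∑ t, M.q t) * w ≤ M.numEdges n)
    (h : ((∑ t, M.q t) * w : ℕ) ≤ κ * (M.numEdges n - ((∑ t, M.q t) * w : ℕ))) :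
    M.expectedNum n w * ((M.numEdges n).choose (M.p * w) * z ^ (M.p * w) * x ^ w) ≤
      (∏ t, (∑ c : M.code t, z ^ hammingNorm c.1) ^ M.numCN n t) *
        ∏ t, (1 + x * (κ / z) ^ (M.q t - M.p)) ^ M.numVN n t := by
  have hPnn : 0 ≤ ∏ t, (∑ c : M.code t, z ^ hammingNorm c.1) ^ M.numCN n t :=
    Finset.prod_nonneg fun t _ => pow_nonneg (Finset.sum_nonneg fun c _ => by positivity) _
  have hA := fun L => M.cnCount_mul_pow_le (M.numCN n) L hz.le
  have hV := sum_vnCount_mul_le (M.numVN n) w (Finset.range (M.numEdges n + 1)) hx.le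
    (div_pos hκ hz)
  rw [hn.expectedNum_eq]
  generalize (∏ t, (∑ c : M.code t, z ^ hammingNorm c.1) ^ M.numCN n t) = P at *
  generalize (∏ t, (1 + x * (κ / z) ^ (M.q t - M.p)) ^ M.numVN n t) = Q at *
  rw [← mul_assoc, Finset.sum_mul]
  refine le_trans ?_ (mul_le_mul_of_nonneg_left hV hPnn)
  rw [← mul_assoc, Finset.mul_sum]
  refine mul_le_mul_of_nonneg_right (Finset.sum_le_sum fun L hL => ?_) (by positivity)
  rcases Nat.eq_zero_or_pos (M.vnCount (M.numVN n) w L) with h0 | hpos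
  · simp [h0]
  · obtain ⟨h1, h2⟩ := mem_range_of_vnCount_pos hpos
    have hLE : L ≤ M.numEdges n := Nat.lt_succ_iff.1 (Finset.mem_range.1 hL)
    have hc : (0 : ℝ) < (M.numEdges n).choose L := by exact_mod_cast Nat.choose_pos hLE
    exact saddle_term_le hκ hz (Nat.cast_nonneg _) (Nat.cast_nonneg _) hc h1
      (choose_le_pow_mul_choose hκ.le hB h h1 h2) (hA L)

theorem log_prod_pow_le {T : Type*} [Fintype T] (m : T → ℕ) (f : T → ℝ) (hf : ∀ t, 0 < f t) :
    Real.log (∏ t, f t ^ m t) ≤ ∑ t, m t * (f t - 1) := by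
  rw [Real.log_prod fun t _ => (pow_pos (hf t) _).ne']
  refine Finset.sum_le_sum fun t _ => ?_
  rw [Real.log_pow]
  exact mul_le_mul_of_nonneg_left (Real.log_le_sub_one_of_pos (hf t)) (by positivity)

/-- The exponent of the saddle point bound. -/
noncomputable def upperExponent (M : GLDPCEnsemble) (α κ x z : ℝ) : ℝ :=
  -(M.p * α * Real.log z) +
    (∑ t, M.rho t / (M.intLam * M.s t) * ((∑ c : M.code t, z ^ hammingNorm c.1) - 1)) -
    α * Real.log x + x * (∑ t, M.delta t * (κ / z) ^ (M.q t - M.p)) +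
    (M.p * α * Real.log (M.p * M.intLam * α) - M.p * α + M.p ^ 2 * M.intLam * α ^ 2)

theorem p_le_sum_q : M.p ≤ ∑ t, M.q t := by
  obtain ⟨t, ht⟩ := M.exists_q_eq_p
  rw [← ht]
  exact Finset.single_le_sum (fun t _ => Nat.zero_le (M.q t)) (Finset.mem_univ t)

/-- Take logarithms in the saddle point bound, using log f ≤ f - 1 for each node factor and the
entropy lower bound for binom(E,pw). The latter accounts for the term log(E + 1). -/
theorem log_expectedNum_le {α κ x z : ℝ} (hα : 0 < α) (hκ : 0 < κ) (hx : 0 < x) (hz : 0 < z)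
    (hlt : (∑ t, (M.q t : ℝ)) * M.intLam * α < 1)
    (h : (∑ t, (M.q t : ℝ)) * M.intLam * α ≤ κ * (1 - (∑ t, (M.q t : ℝ)) * M.intLam * α))
    {n w : ℕ} (hn : M.Admissible n) (hw : (w : ℝ) = α * n) (hpos : 0 < M.expectedNum n w) :
    Real.log (M.expectedNum n w) ≤
      n * M.upperExponent α κ x z + Real.log (n / M.intLam + 1) := by
  have hI := M.intLam_pos
  have hn0 : (0 : ℝ) < n := by exact_mod_cast hn.1
  have hE := hn.numEdges_eq
  have hEpos : (0 : ℝ) < M.numEdges n := by exact_mod_cast hn.numEdges_pos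
  have hnE : (n : ℝ) = M.numEdges n * M.intLam := by rw [hE]; field_simp
  have hB : (((∑ t, M.q t) * w : ℕ) : ℝ) =
      M.numEdges n * ((∑ t, (M.q t : ℝ)) * M.intLam * α) := by
    push_cast
    rw [hw, hnE]; ring
  have hBlt : (∑ t, M.q t) * w < M.numEdges n := by
    have : (((∑ t, M.q t) * w : ℕ) : ℝ) < M.numEdges n := by
      rw [hB]
      exact mul_lt_of_lt_one_right hEpos hlt
    exact_mod_cast this
  have hwpos : 0 < w := by
    have : (0 : ℝ) < w := by rw [hw]; positivity
    exact_mod_cast this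
  have hp := M.two_le_p
  have hpw : M.p * w < M.numEdges n := (Nat.mul_le_mul_right w p_le_sum_q).trans_lt hBlt
  have hpw0 : 0 < M.p * w := Nat.mul_pos (by omega) hwpos
  have hmain := hn.expectedNum_mul_le hκ hx hz hBlt.le (by rw [hB]; nlinarith)
  have hc : (0 : ℝ) < (M.numEdges n).choose (M.p * w) := by exact_mod_cast Nat.choose_pos hpw.le
  have hA : ∀ t, 0 < ∑ c : M.code t, z ^ hammingNorm c.1 := fun t =>
    Finset.sum_pos (fun c _ => by positivity) Finset.univ_nonempty
  have hV : ∀ t, 0 < 1 + x * (κ / z) ^ (M.q t - M.p) := fun t => by positivity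
  have hlog := Real.log_le_log (by positivity) hmain
  rw [Real.log_mul hpos.ne' (by positivity), Real.log_mul (by positivity) (by positivity),
    Real.log_mul (by positivity) (by positivity), Real.log_pow, Real.log_pow,
    Real.log_mul (Finset.prod_pos fun t _ => pow_pos (hA t) _).ne'
      (Finset.prod_pos fun t _ => pow_pos (hV t) _).ne'] at hlog
  have h1 := log_prod_pow_le (M.numCN n) _ hA
  have h2 := log_prod_pow_le (M.numVN n) _ hV
  have h3 := le_log_choose hpw0 hpw
  have hθ : ((M.p * w : ℕ) : ℝ) / M.numEdges n = M.p * M.intLam * α := by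
    push_cast
    rw [hw, div_eq_iff hEpos.ne', hnE]; ring
  have hpwE : ((M.p * w : ℕ) : ℝ) = M.numEdges n * (M.p * M.intLam * α) := by
    rw [← hθ]; field_simp
  have hθlt : (M.p : ℝ) * M.intLam * α < 1 := by
    rw [← hθ, div_lt_one hEpos]; exact_mod_cast hpw
  rw [hθ, hE] at h3
  have h4 := one_sub_mul_log_one_sub_le hθlt
  have h5 : ∑ t, (M.numCN n t : ℝ) * ((∑ c : M.code t, z ^ hammingNorm c.1) - 1) =
      n * ∑ t, M.rho t / (M.intLam * M.s t) * ((∑ c : M.code t, z ^ hammingNorm c.1) - 1) := by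
    rw [Finset.mul_sum]
    refine Finset.sum_congr rfl fun t _ => ?_
    rw [hn.numCN_eq]; ring
  have h6 : ∑ t, (M.numVN n t : ℝ) * (1 + x * (κ / z) ^ (M.q t - M.p) - 1) =
      n * (x * ∑ t, M.delta t * (κ / z) ^ (M.q t - M.p)) := by
    rw [Finset.mul_sum, Finset.mul_sum]
    refine Finset.sum_congr rfl fun t _ => ?_
    rw [hn.numVN_eq]; ring
  rw [h5] at h1
  rw [h6] at h2
  have hpwn : ((M.p * w : ℕ) : ℝ) = n * (M.p * α) := by push_cast; rw [hw]; ring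
  have h7 : ((n : ℝ) / M.intLam - (M.p * w : ℕ)) * Real.log (1 - M.p * M.intLam * α) ≤
      n * (-(M.p * α) + M.p ^ 2 * M.intLam * α ^ 2) := by
    have e1 : ((n : ℝ) / M.intLam - (M.p * w : ℕ)) =
        n / M.intLam * (1 - M.p * M.intLam * α) := by rw [hpwn]; field_simp
    rw [e1, mul_assoc]
    refine (mul_le_mul_of_nonneg_left h4 (by positivity)).trans (le_of_eq ?_)
    field_simp
  rw [hpwn] at h3 h7 hlog
  rw [hw] at hlog
  unfold upperExponent
  linarith

theorem growth_le_upperExponent {α κ x z l : ℝ} (hα : 0 < α) (hκ : 0 < κ) (hx : 0 < x)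
    (hz : 0 < z) (hsmall : (∑ t, (M.q t : ℝ)) * M.intLam * α < 1)
    (h : (∑ t, (M.q t : ℝ)) * M.intLam * α ≤ κ * (1 - (∑ t, (M.q t : ℝ)) * M.intLam * α))
    [(M.growthFilter α).NeBot] (hl : Tendsto (M.normalizedLog α) (M.growthFilter α) (𝓝 l)) :
    l ≤ M.upperExponent α κ x z := by
  have h1 : Tendsto (fun n : ℕ => M.upperExponent α κ x z + Real.log (n / M.intLam + 1) / n)
      (M.growthFilter α) (𝓝 (M.upperExponent α κ x z + 0)) :=
    tendsto_const_nhds.add ((tendsto_log_mul_add_one_div _ M.intLam_pos).mono_left inf_le_left)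
  rw [add_zero] at h1
  refine le_of_tendsto_of_tendsto hl h1 ?_
  unfold growthFilter
  refine eventually_inf_principal.2 (Eventually.of_forall ?_)
  rintro n ⟨hn, w, hw, hpos⟩
  have hn0 : (0 : ℝ) < n := by exact_mod_cast hn.1
  have h2 := log_expectedNum_le hα hκ hx hz hsmall h hn hw hpos
  rw [normalizedLog, ← hw, Nat.floor_natCast, one_div, inv_mul_le_iff₀ hn0]
  refine h2.trans (le_of_eq ?_)
  field_simp

end GLDPCEnsemble

/-! ### Expansion of the upper exponent at the saddle point -/

namespace GLDPCEnsemble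

variable (M : GLDPCEnsemble)

theorem delta_pos (t : Fin M.nv) : 0 < M.delta t := by
  have h1 := M.intLam_pos
  have h2 : (0 : ℝ) < M.lam t := by exact_mod_cast M.lam_pos t
  have h3 : (0 : ℝ) < M.q t := by exact_mod_cast M.q_pos t
  unfold delta
  positivity

theorem deltaTilde_pos : 0 < M.deltaTilde := by
  obtain ⟨t, ht⟩ := M.exists_q_eq_p
  exact Finset.sum_pos (fun t _ => M.delta_pos t) ⟨t, by simp [ht]⟩

theorem A_r_eq_zero {t : Fin M.nc} (h : M.minDist t ≠ M.r) : M.A t M.r = 0 := by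
  unfold A
  rw [Nat.card_eq_zero]
  left
  refine ⟨fun ⟨c, hc, hw⟩ => ?_⟩
  have hr := M.two_le_r
  have hc0 : c ≠ 0 := by
    rintro rfl
    rw [hammingNorm_zero] at hw
    omega
  have h1 := M.minDist_le_hammingNorm hc hc0
  have h2 := M.r_le_minDist t
  omega

theorem C_eq : M.C = M.r * ∑ t, (M.rho t : ℝ) * M.A t M.r / M.s t := by
  unfold C
  congr 1
  rw [Finset.sum_filter]
  refine Finset.sum_congr rfl fun t _ => ?_
  split_ifs with h
  · rfl
  · simp [M.A_r_eq_zero h]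

theorem C_pos : 0 < M.C := by
  obtain ⟨t, ht⟩ := M.exists_minDist_eq_r
  have hr : (0 : ℝ) < M.r := by exact_mod_cast (by have := M.two_le_r; omega : 0 < M.r)
  refine mul_pos hr (Finset.sum_pos (fun t ht => ?_) ⟨t, by simp [ht]⟩)
  have h1 : (0 : ℝ) < M.rho t := by exact_mod_cast M.rho_pos t
  have h2 : (0 : ℝ) < M.s t := by exact_mod_cast M.s_pos t
  have h3 : (0 : ℝ) < M.A t M.r := by
    rw [← (Finset.mem_filter.1 ht).2]
    exact_mod_cast M.A_minDist_pos t
  positivity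

theorem r_cast_ge : (2 : ℝ) ≤ M.r := by exact_mod_cast M.two_le_r

theorem p_cast_ge : (2 : ℝ) ≤ M.p := by exact_mod_cast M.two_le_p

theorem psi_pos : 0 < M.psi := by
  have := M.r_cast_ge
  exact div_pos (by linarith) (by linarith)

theorem bddBelow_xi_set : BddBelow (({2} : Set ℝ)
    ∪ {x | ∃ t u, M.r < u ∧ 0 < M.A t u ∧ x = (u : ℝ) / (M.r : ℝ)}
    ∪ {x | ∃ t, M.p < M.q t ∧ x = ((M.q t : ℝ) - (M.p : ℝ)) / M.psi + 1}) := by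
  refine ⟨0, ?_⟩
  rintro x ((rfl | ⟨t, u, -, -, rfl⟩) | ⟨t, ht, rfl⟩)
  · norm_num
  · positivity
  · have h1 : (M.p : ℝ) < M.q t := by exact_mod_cast ht
    have h2 := M.psi_pos
    have h3 : 0 < (M.q t : ℝ) - M.p := by linarith
    positivity

theorem xi_le_two : M.xi ≤ 2 := csInf_le M.bddBelow_xi_set (Or.inl (Or.inl rfl))

theorem xi_le_div_r {t : Fin M.nc} {u : ℕ} (hu : M.r < u) (hA : 0 < M.A t u) :
    M.xi ≤ (u : ℝ) / M.r :=
  csInf_le M.bddBelow_xi_set (Or.inl (Or.inr ⟨t, u, hu, hA, rfl⟩))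

theorem xi_le_of_p_lt {t : Fin M.nv} (ht : M.p < M.q t) :
    M.xi ≤ ((M.q t : ℝ) - M.p) / M.psi + 1 :=
  csInf_le M.bddBelow_xi_set (Or.inr ⟨t, ht, rfl⟩)

/-- The leading terms of the growth rate for small weights. -/
noncomputable def mainTerm (α : ℝ) : ℝ :=
  ((M.p : ℝ) - (M.p : ℝ) / (M.r : ℝ) - 1) * α * Real.log α + M.K * α

/-- The shape in which both bounds produce it: a check-node part, a variable-node part and the
entropy of choosing p w edges. -/
theorem mainTerm_eq {α : ℝ} (hα : 0 < α) :
    M.mainTerm α = -(M.p * α / M.r * Real.log (M.p * M.intLam * α / M.C)) + M.p * α / M.r -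
      α * Real.log (α / M.deltaTilde) + α +
      (M.p * α * Real.log (M.p * M.intLam * α) - M.p * α) := by
  have hI := M.intLam_pos.ne'
  have hp : (M.p : ℝ) ≠ 0 := by have := M.p_cast_ge; linarith
  have hr : (M.r : ℝ) ≠ 0 := by have := M.r_cast_ge; linarith
  unfold mainTerm K psi
  rw [Real.log_mul (Real.exp_pos 1).ne' M.deltaTilde_pos.ne', Real.log_exp,
    Real.log_div (mul_ne_zero hp hI) (Real.exp_pos 1).ne', Real.log_exp,
    Real.log_div (by positivity) M.C_pos.ne', Real.log_div hα.ne' M.deltaTilde_pos.ne',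
    Real.log_mul (mul_ne_zero hp hI) hα.ne']
  field_simp
  ring

theorem sum_pow_hammingNorm_le (t : Fin M.nc) {z : ℝ} (hz : 0 < z) (hz1 : z ≤ 1) :
    (∑ c : M.code t, z ^ hammingNorm c.1) - 1 ≤
      M.A t M.r * z ^ M.r + Fintype.card (M.code t) * (z ^ M.r) ^ M.xi := by
  classical
  have hr : (0 : ℝ) < M.r := by have := M.r_cast_ge; linarith
  have hr2 := M.two_le_r
  -- The zero word, the words of weight r, and the heavier ones, for which u ≥ rξ and z ≤ 1 give z^u
  -- ≤ (z^r)^ξ.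
  have h1 : ∀ c : M.code t, z ^ hammingNorm c.1 ≤ (if c = 0 then 1 else 0) +
      ((if M.cnWeight t c = M.r then z ^ M.r else 0) + (z ^ M.r) ^ M.xi) := by
    intro c
    have hpos : 0 ≤ (z ^ M.r) ^ M.xi := by positivity
    have hpos' : 0 ≤ z ^ M.r := by positivity
    by_cases hc : c = 0
    · subst hc
      simp only [ZeroMemClass.coe_zero, hammingNorm_zero, pow_zero, if_true]
      split_ifs <;> linarith
    · rw [if_neg hc, zero_add]
      have hc0 : c.1 ≠ 0 := fun h => hc (Subtype.ext h)
      have hge := (M.r_le_minDist t).trans (M.minDist_le_hammingNorm c.2 hc0)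
      by_cases hw : M.cnWeight t c = M.r
      · rw [if_pos hw]
        have : hammingNorm c.1 = M.r := hw
        rw [this]
        linarith
      · rw [if_neg hw, zero_add]
        have hlt : M.r < hammingNorm c.1 := lt_of_le_of_ne hge (Ne.symm hw)
        have hA : 0 < M.A t (hammingNorm c.1) := by
          unfold A
          rw [Nat.card_pos_iff]
          exact ⟨⟨⟨c.1, c.2, rfl⟩⟩, inferInstance⟩
        have h2 := M.xi_le_div_r hlt hA
        rw [← Real.rpow_natCast z M.r, ← Real.rpow_mul hz.le, ← Real.rpow_natCast]
        refine Real.rpow_le_rpow_of_exponent_ge hz hz1 ?_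
        rw [le_div_iff₀ hr] at h2
        linarith
  have h2 := Finset.sum_le_sum fun c (_ : c ∈ Finset.univ) => h1 c
  rw [Finset.sum_add_distrib, Finset.sum_add_distrib, Finset.sum_ite_eq' Finset.univ] at h2
  rw [← Finset.sum_filter, Finset.sum_const, Finset.sum_const, nsmul_eq_mul, nsmul_eq_mul,
    Finset.card_univ] at h2
  have h3 : (Finset.univ.filter fun c : M.code t => M.cnWeight t c = M.r).card = M.A t M.r := by
    rw [A_eq_card, Nat.card_eq_fintype_card, Fintype.card_subtype]
  rw [h3] at h2
  simp only [Finset.mem_univ, if_true] at h2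
  linarith

/-- At the minimizer of the leading part the exponent equals the main term, and each correction is
O(α^ξ) by one of the bounds defining ξ. -/
theorem exists_upperExponent_le :
    ∃ k ≥ 0, ∃ ε > (0 : ℝ), ∀ α, 0 < α → α ≤ ε →
      (∑ t, (M.q t : ℝ)) * M.intLam * α < 1 ∧
      ∃ κ > 0, ∃ x > 0, ∃ z > 0,
      (∑ t, (M.q t : ℝ)) * M.intLam * α ≤ κ * (1 - (∑ t, (M.q t : ℝ)) * M.intLam * α) ∧
      M.upperExponent α κ x z ≤ M.mainTerm α + k * α ^ M.xi := by
  have hI := M.intLam_pos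
  have hC := M.C_pos
  have hδ := M.deltaTilde_pos
  have hp := M.p_cast_ge
  have hr := M.r_cast_ge
  set Q : ℝ := ∑ t, (M.q t : ℝ) with hQ
  have hQpos : 0 < Q := by
    have : (M.p : ℝ) ≤ Q := by rw [hQ]; exact_mod_cast M.p_le_sum_q
    linarith
  set c₂ : ℝ := M.p * M.intLam / M.C with hc₂
  have hc₂pos : 0 < c₂ := by positivity
  -- The constants are arranged so that z^r = c₂ α and κ/z = c₃ α^(1/ψ).
  set c₃ : ℝ := 2 * Q * M.intLam / c₂ ^ (1 / (M.r : ℝ)) with hc₃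
  have hc₃pos : 0 < c₃ := by positivity
  have hs : ∀ t, (0 : ℝ) < M.s t := fun t => by exact_mod_cast M.s_pos t
  have hρ : ∀ t, (0 : ℝ) < M.rho t := fun t => by exact_mod_cast M.rho_pos t
  set k₁ : ℝ := ∑ t, M.rho t / (M.intLam * M.s t) * Fintype.card (M.code t) with hk₁
  have hk₁nn : 0 ≤ k₁ := Finset.sum_nonneg fun t _ => by
    have := hs t
    have := hρ t
    positivity
  set k₂ : ℝ := ∑ t, M.delta t * c₃ ^ (M.q t - M.p) with hk₂
  have hk₂nn : 0 ≤ k₂ := Finset.sum_nonneg fun t _ => by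
    have := M.delta_pos t
    positivity
  refine ⟨k₁ * c₂ ^ M.xi + k₂ / M.deltaTilde + M.p ^ 2 * M.intLam, by positivity,
    min 1 (min (1 / (2 * Q * M.intLam)) (1 / c₂)), by positivity, fun α hα hle => ?_⟩
  have hα1 : α ≤ 1 := hle.trans (min_le_left _ _)
  have hαQ : α * (2 * Q * M.intLam) ≤ 1 := (le_div_iff₀ (by positivity)).1
    (hle.trans ((min_le_right _ _).trans (min_le_left _ _)))
  have hαc : α * c₂ ≤ 1 := (le_div_iff₀ (by positivity)).1
    (hle.trans ((min_le_right _ _).trans (min_le_right _ _)))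
  have hQα : Q * M.intLam * α ≤ 1 / 2 := by linarith
  have hQα0 : 0 < Q * M.intLam * α := by positivity
  -- Here x minimizes -α log x + δ̃ x, and z minimizes -pα log z + C z^r/(r∫λ). The factor 2 in κ
  -- absorbs 1 - Q∫λ α ≥ 1/2.
  refine ⟨by linarith, 2 * Q * M.intLam * α, by positivity, α / M.deltaTilde, by positivity,
    (c₂ * α) ^ (1 / (M.r : ℝ)), by positivity, by nlinarith, ?_⟩
  set z : ℝ := (c₂ * α) ^ (1 / (M.r : ℝ)) with hz
  have hzpos : 0 < z := by positivity
  have hz1 : z ≤ 1 := Real.rpow_le_one (by positivity) (by linarith) (by positivity)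
  have hzr : z ^ M.r = c₂ * α := by
    rw [hz, ← Real.rpow_natCast, ← Real.rpow_mul (by positivity), one_div,
      inv_mul_cancel₀ (by linarith), Real.rpow_one]
  have hθ : c₂ * α = M.p * M.intLam * α / M.C := by rw [hc₂]; ring
  have hlogz : Real.log z = Real.log (M.p * M.intLam * α / M.C) / M.r := by
    rw [hz, Real.log_rpow (by positivity), hθ]; ring
  have hcn : ∑ t, M.rho t / (M.intLam * M.s t) * ((∑ c : M.code t, z ^ hammingNorm c.1) - 1) ≤
      M.p * α / M.r + k₁ * c₂ ^ M.xi * α ^ M.xi := by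
    calc ∑ t, M.rho t / (M.intLam * M.s t) * ((∑ c : M.code t, z ^ hammingNorm c.1) - 1)
        ≤ ∑ t, M.rho t / (M.intLam * M.s t) *
          (M.A t M.r * z ^ M.r + Fintype.card (M.code t) * (z ^ M.r) ^ M.xi) := by
          refine Finset.sum_le_sum fun t _ => mul_le_mul_of_nonneg_left
            (M.sum_pow_hammingNorm_le t hzpos hz1) ?_
          have := hs t
          have := hρ t
          positivity
      _ = (∑ t, (M.rho t : ℝ) * M.A t M.r / M.s t) * z ^ M.r / M.intLam +
          k₁ * (z ^ M.r) ^ M.xi := by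
          rw [hk₁, Finset.sum_mul, Finset.sum_mul, Finset.sum_div, ← Finset.sum_add_distrib]
          refine Finset.sum_congr rfl fun t _ => ?_
          have := (hs t).ne'
          field_simp
      _ = M.p * α / M.r + k₁ * c₂ ^ M.xi * α ^ M.xi := by
          have hsum : (∑ t, (M.rho t : ℝ) * M.A t M.r / M.s t) = M.C / M.r := by
            rw [M.C_eq]; field_simp
          rw [hsum, hzr, Real.mul_rpow hc₂pos.le hα.le, hc₂]
          field_simp
  have hκz : 2 * Q * M.intLam * α / z = c₃ * α ^ (1 / M.psi) := by
    have e : (1 / M.psi) = 1 - 1 / (M.r : ℝ) := by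
      unfold psi
      have : (M.r : ℝ) - 1 ≠ 0 := by linarith
      field_simp
    rw [e, Real.rpow_sub hα, Real.rpow_one, hz, Real.mul_rpow hc₂pos.le hα.le, hc₃]
    field_simp
  have hvn : α / M.deltaTilde * ∑ t, M.delta t * (2 * Q * M.intLam * α / z) ^ (M.q t - M.p) ≤
      α + k₂ / M.deltaTilde * α ^ M.xi := by
    have hterm : ∀ t, α * (M.delta t * (2 * Q * M.intLam * α / z) ^ (M.q t - M.p)) ≤
        α * (if M.q t = M.p then M.delta t else 0) +
          M.delta t * c₃ ^ (M.q t - M.p) * α ^ M.xi := by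
      intro t
      have hd := M.delta_pos t
      split_ifs with h
      · rw [h, Nat.sub_self, pow_zero, mul_one]
        have : 0 ≤ M.delta t * c₃ ^ 0 * α ^ M.xi := by positivity
        linarith
      · have hlt : M.p < M.q t := lt_of_le_of_ne (M.p_le_q t) (Ne.symm h)
        have hxi := M.xi_le_of_p_lt hlt
        -- One factor α comes from x, and α^(1/ψ) from each of the q_t - p excess edges.
        have hpw : α * (α ^ (1 / M.psi)) ^ (M.q t - M.p) ≤ α ^ M.xi := by
          rw [← Real.rpow_natCast, ← Real.rpow_mul hα.le, Nat.cast_sub hlt.le]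
          calc α * α ^ (1 / M.psi * ((M.q t : ℝ) - M.p))
              = α ^ (((M.q t : ℝ) - M.p) / M.psi + 1) := by
                rw [Real.rpow_add hα, Real.rpow_one, mul_comm]
                congr 2
                ring
            _ ≤ α ^ M.xi := Real.rpow_le_rpow_of_exponent_ge hα hα1 hxi
        rw [hκz, mul_pow, mul_zero, zero_add]
        calc α * (M.delta t * (c₃ ^ (M.q t - M.p) * (α ^ (1 / M.psi)) ^ (M.q t - M.p)))
            = M.delta t * c₃ ^ (M.q t - M.p) * (α * (α ^ (1 / M.psi)) ^ (M.q t - M.p)) := by ring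
          _ ≤ _ := by gcongr
    have hsum := Finset.sum_le_sum fun t (_ : t ∈ Finset.univ) => hterm t
    rw [Finset.sum_add_distrib, ← Finset.mul_sum, ← Finset.mul_sum, ← Finset.sum_mul, ← hk₂,
      ← Finset.sum_filter] at hsum
    change _ ≤ α * M.deltaTilde + _ at hsum
    rw [div_mul_eq_mul_div, div_le_iff₀ hδ]
    refine hsum.trans (le_of_eq ?_)
    field_simp
  have hsq : α ^ 2 ≤ α ^ M.xi := by
    have := Real.rpow_le_rpow_of_exponent_ge hα hα1 M.xi_le_two
    rwa [Real.rpow_two] at this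
  have hsq' : M.p ^ 2 * M.intLam * α ^ 2 ≤ M.p ^ 2 * M.intLam * α ^ M.xi := by gcongr
  rw [M.mainTerm_eq hα]
  unfold upperExponent
  rw [hlogz]
  have e : (M.p : ℝ) * α * (Real.log (M.p * M.intLam * α / M.C) / M.r) =
    M.p * α / M.r * Real.log (M.p * M.intLam * α / M.C) := by ring
  rw [e]
  linarith

end GLDPCEnsemble

/-! ### The lower bound from balanced configurations -/

/-- The entropy bound expanded to second order. The endpoints k = 0 and k = m are included, since a
node type may be left unused or used completely. -/
theorem le_log_choose_of_le {m k : ℕ} (h : k ≤ m) :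
    -(k * Real.log ((k : ℝ) / m)) + k - k * ((k : ℝ) / m) - Real.log (m + 1) ≤
      Real.log (m.choose k) := by
  have hlog : 0 ≤ Real.log ((m : ℝ) + 1) :=
    Real.log_nonneg (by have : (0 : ℝ) ≤ m := by positivity
                        linarith)
  rcases Nat.eq_zero_or_pos k with rfl | hk
  · simpa using hlog
  rcases h.eq_or_lt with rfl | hlt
  · have : (k : ℝ) ≠ 0 := by exact_mod_cast hk.ne'
    simp [div_self this, hlog]
  have hm : (0 : ℝ) < m := by exact_mod_cast hk.trans hlt
  have h1 := le_log_choose hk hlt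
  have h2 := one_sub_mul_log_one_sub_le ((div_lt_one hm).2 (by exact_mod_cast hlt : (k : ℝ) < m))
  have h3 : ((m : ℝ) - k) * Real.log (1 - k / m) ≤ -k + k * ((k : ℝ) / m) := by
    have e : (m : ℝ) - k = m * (1 - k / m) := by field_simp
    rw [e, mul_assoc]
    refine (mul_le_mul_of_nonneg_left h2 hm.le).trans (le_of_eq ?_)
    field_simp
  linarith

/-- Lower bound for the number of selections with prescribed proportions. -/
theorem le_log_prod_choose_mul_pow {T : Type*} [Fintype T] (m k A : T → ℕ) {x a : ℝ} (hx : 0 < x)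
    (hk : ∀ t, (k t : ℝ) = A t * x * m t) (ha : ∀ t, (A t : ℝ) ≤ a) (hax : a * x ≤ 1) {E : ℕ}
    (hm : ∀ t, m t ≤ E) :
    0 < ∏ t, (m t).choose (k t) * A t ^ k t ∧
    (∑ t, (k t : ℝ)) * (-Real.log x + 1 - a * x) - Fintype.card T * Real.log (E + 1) ≤
      Real.log ((∏ t, (m t).choose (k t) * A t ^ k t : ℕ) : ℝ) := by
  have hkm : ∀ t, k t ≤ m t := by
    intro t
    have h1 : (A t : ℝ) * x ≤ 1 := (mul_le_mul_of_nonneg_right (ha t) hx.le).trans hax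
    have h2 : (k t : ℝ) ≤ m t := by
      rw [hk t]
      exact mul_le_of_le_one_left (Nat.cast_nonneg _) h1
    exact_mod_cast h2
  have hA : ∀ t, k t ≠ 0 → 0 < A t := by
    intro t h
    rw [Nat.pos_iff_ne_zero]
    intro h0
    have := hk t
    rw [h0, Nat.cast_zero, zero_mul, zero_mul] at this
    exact h (by exact_mod_cast this)
  have hpow : ∀ t, 0 < A t ^ k t := by
    intro t
    by_cases h : k t = 0
    · simp [h]
    · exact pow_pos (hA t h) _
  have hpos : ∀ t, 0 < (m t).choose (k t) * A t ^ k t := fun t =>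
    Nat.mul_pos (Nat.choose_pos (hkm t)) (hpow t)
  refine ⟨Finset.prod_pos fun t _ => hpos t, ?_⟩
  rw [Nat.cast_prod, Real.log_prod fun t _ => by exact_mod_cast (hpos t).ne', Finset.sum_mul,
    ← nsmul_eq_mul, ← Finset.card_univ, ← Finset.sum_const, ← Finset.sum_sub_distrib]
  refine Finset.sum_le_sum fun t _ => ?_
  have h1 := le_log_choose_of_le (hkm t)
  have h2 : Real.log ((m t : ℝ) + 1) ≤ Real.log (E + 1) := by
    refine Real.log_le_log (by positivity) ?_
    have : (m t : ℝ) ≤ E := by exact_mod_cast hm t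
    linarith
  have hc : (0 : ℝ) < (m t).choose (k t) := by exact_mod_cast Nat.choose_pos (hkm t)
  push_cast
  rw [Real.log_mul hc.ne' (by exact_mod_cast (hpow t).ne'), Real.log_pow]
  by_cases h : k t = 0
  · rw [h] at h1 ⊢
    simp only [Nat.cast_zero, zero_mul, neg_zero] at h1 ⊢
    linarith
  · have hAt : (0 : ℝ) < A t := by exact_mod_cast hA t h
    have hmt : (0 : ℝ) < m t := by exact_mod_cast (Nat.pos_of_ne_zero h).trans_le (hkm t)
    -- With selections proportional to A_t, the log A_t in the entropy cancels against that of
    -- A_t^k_t, leaving -log x for every type.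
    have hq : (k t : ℝ) / m t = A t * x := by rw [hk t]; field_simp
    rw [hq, Real.log_mul hAt.ne' hx.ne'] at h1
    have h3 : (k t : ℝ) * (A t * x) ≤ k t * (a * x) := by
      have := ha t
      gcongr
    nlinarith

/-- The product of the denominators clears all of them at once. -/
theorem exists_nat_mul_eq_of_rat {T : Type*} [Fintype T] (c : T → ℝ) (h0 : ∀ t, 0 ≤ c t)
    (hc : ∀ t, c t ∈ (Rat.castHom ℝ).fieldRange) :
    ∃ N : ℕ, 0 < N ∧ ∀ j : ℕ, ∃ f : T → ℕ, ∀ t, (f t : ℝ) = (N * j : ℕ) * c t := by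
  classical
  choose q hq using fun t => (RingHom.mem_fieldRange.1 (hc t))
  have hq' : ∀ t, c t = (q t : ℝ) := fun t => (hq t).symm
  have hq0 : ∀ t, 0 ≤ q t := by
    intro t
    have := h0 t
    rw [hq' t] at this
    exact_mod_cast this
  refine ⟨∏ t, (q t).den, Finset.prod_pos fun t _ => (q t).den_pos, fun j =>
    ⟨fun t => (∏ i ∈ Finset.univ.erase t, (q i).den) * j * (q t).num.toNat, fun t => ?_⟩⟩
  rw [hq' t, ← Finset.mul_prod_erase Finset.univ _ (Finset.mem_univ t)]
  have h1 : (((q t).num.toNat : ℕ) : ℝ) = ((q t).den : ℝ) * (q t : ℝ) := by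
    have h2 : (((q t).num.toNat : ℤ) : ℝ) = ((q t).num : ℝ) := by
      rw [Int.toNat_of_nonneg (Rat.num_nonneg.2 (hq0 t))]
    have h3 : ((q t).num : ℝ) = ((q t).den : ℝ) * (q t : ℝ) := by
      exact_mod_cast (by rw [mul_comm]; exact (Rat.mul_den_eq_num (q t)).symm :
        ((q t).num : ℚ) = ((q t).den : ℚ) * q t)
    rw [← h3, ← h2]
    push_cast
    rfl
  push_cast
  rw [h1]
  ring

namespace GLDPCEnsemble

variable (M : GLDPCEnsemble)

theorem intLam_mem : M.intLam ∈ (Rat.castHom ℝ).fieldRange := by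
  rw [intLam_eq]
  exact sum_mem fun t _ => div_mem ⟨M.lam t, rfl⟩ (natCast_mem _ _)

theorem C_mem : M.C ∈ (Rat.castHom ℝ).fieldRange := by
  rw [C_eq]
  exact mul_mem (natCast_mem _ _) (sum_mem fun t _ =>
    div_mem (mul_mem ⟨M.rho t, rfl⟩ (natCast_mem _ _)) (natCast_mem _ _))

theorem delta_mem (t : Fin M.nv) : M.delta t ∈ (Rat.castHom ℝ).fieldRange :=
  div_mem ⟨M.lam t, rfl⟩ (mul_mem (natCast_mem _ _) M.intLam_mem)

theorem deltaTilde_mem : M.deltaTilde ∈ (Rat.castHom ℝ).fieldRange :=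
  sum_mem fun t _ => M.delta_mem t

/-- Block lengths for which the codewords that use only variable nodes of degree `p` and local
codewords of weight `r` can be spread proportionally over the node types. -/
theorem exists_balanced_blockLength (α : ℚ) (hα : 0 ≤ α) :
    ∃ N : ℕ, 0 < N ∧ ∀ j : ℕ, 0 < j → M.Admissible (N * j) ∧
      (∃ k : Fin M.nc → ℕ, ∀ t, (k t : ℝ) =
        M.A t M.r * (M.p * M.intLam * α / M.C) * M.numCN (N * j) t) ∧
      (∃ k : Fin M.nv → ℕ, ∀ t, (k t : ℝ) =
        (if M.q t = M.p then 1 else 0 : ℕ) * (α / M.deltaTilde) * M.numVN (N * j) t) := by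
  have hI := M.intLam_pos
  have hC := M.C_pos
  have hδ := M.deltaTilde_pos
  have hα' : (0 : ℝ) ≤ α := by exact_mod_cast hα
  have hρ : ∀ t, (0 : ℝ) < M.rho t := fun t => by exact_mod_cast M.rho_pos t
  have hαm : (α : ℝ) ∈ (Rat.castHom ℝ).fieldRange := ⟨α, rfl⟩
  have hcm : ∀ t, (M.rho t : ℝ) / (M.intLam * M.s t) ∈ (Rat.castHom ℝ).fieldRange := fun t =>
    div_mem ⟨M.rho t, rfl⟩ (mul_mem M.intLam_mem (natCast_mem _ _))
  -- Four families must be integral together: all check nodes, those carrying a word of weight r,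
  -- all variable nodes, and those set to one.
  obtain ⟨N, hN, h⟩ := exists_nat_mul_eq_of_rat
    (Sum.elim (Sum.elim (fun t => (M.rho t : ℝ) / (M.intLam * M.s t))
      (fun t => M.A t M.r * (M.p * M.intLam * α / M.C) * ((M.rho t : ℝ) / (M.intLam * M.s t))))
      (Sum.elim M.delta (fun t => ((if M.q t = M.p then 1 else 0 : ℕ) : ℝ) * (α / M.deltaTilde) *
        M.delta t)))
    (by
      rintro ((t | t) | (t | t))
      · have := hρ t
        simp only [Sum.elim_inl]
        positivity
      · have := hρ t
        simp only [Sum.elim_inl, Sum.elim_inr]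
        positivity
      · exact (M.delta_pos t).le
      · have := M.delta_pos t
        simp only [Sum.elim_inr]
        positivity)
    (by
      rintro ((t | t) | (t | t))
      · exact hcm t
      · exact mul_mem (mul_mem (natCast_mem _ _) (div_mem (mul_mem (mul_mem (natCast_mem _ _)
          M.intLam_mem) hαm) M.C_mem)) (hcm t)
      · exact M.delta_mem t
      · exact mul_mem (mul_mem (natCast_mem _ _) (div_mem hαm M.deltaTilde_mem)) (M.delta_mem t))
  refine ⟨N, hN, fun j hj => ?_⟩
  obtain ⟨f, hf⟩ := h j
  have hCN : ∀ t, M.edges (N * j) * M.rho t / M.s t = (f (Sum.inl (Sum.inl t)) : ℝ) := by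
    intro t
    have hs : (M.s t : ℝ) ≠ 0 := by exact_mod_cast (M.s_pos t).ne'
    rw [hf, edges]
    simp only [Sum.elim_inl]
    field_simp
  have hVN : ∀ t, M.edges (N * j) * M.lam t / M.q t = (f (Sum.inr (Sum.inl t)) : ℝ) := by
    intro t
    have hs : (M.q t : ℝ) ≠ 0 := by exact_mod_cast (M.q_pos t).ne'
    rw [hf, edges]
    simp only [Sum.elim_inl, Sum.elim_inr, delta]
    field_simp
  have hadm : M.Admissible (N * j) := by
    refine ⟨Nat.mul_pos hN hj, fun t => ?_, fun t => ?_⟩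
    · rw [numCN, hCN, Nat.floor_natCast]
    · rw [numVN, hVN, Nat.floor_natCast]
  refine ⟨hadm, ⟨fun t => f (Sum.inl (Sum.inr t)), fun t => ?_⟩,
    ⟨fun t => f (Sum.inr (Sum.inr t)), fun t => ?_⟩⟩
  · rw [hf, hadm.numCN_eq]
    simp only [Sum.elim_inl, Sum.elim_inr]
    ring
  · rw [hf, hadm.numVN_eq]
    simp only [Sum.elim_inr]
    ring

variable {M}

theorem prod_choose_le_cnCount (m k : Fin M.nc → ℕ) :
    ∏ t, (m t).choose (k t) * M.A t M.r ^ k t ≤ M.cnCount m ((∑ t, k t) * M.r) := by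
  have h := prod_listCount_le M.cnWeight m (fun t => k t • M.r)
  rw [← Finset.sum_smul, smul_eq_mul] at h
  refine le_trans (Finset.prod_le_prod' fun t _ => ?_) h
  rw [A_eq_card]
  exact choose_mul_pow_le_listCount (M.cnWeight t) 0 hammingNorm_zero M.r
    (by have := M.two_le_r; omega) _ _

theorem prod_choose_le_vnCount (m k : Fin M.nv → ℕ) (hk : ∀ t, M.q t ≠ M.p → k t = 0) :
    ∏ t, (m t).choose (k t) * (if M.q t = M.p then 1 else 0) ^ k t ≤
      M.vnCount m (∑ t, k t) (M.p * ∑ t, k t) := by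
  have h := prod_listCount_le M.vnWeight m (fun t => k t • (1, M.p))
  rw [← Finset.sum_smul] at h
  have e : (∑ t, k t) • ((1, M.p) : ℕ × ℕ) = (∑ t, k t, M.p * ∑ t, k t) := by
    simp [mul_comm]
  rw [e] at h
  refine le_trans (Finset.prod_le_prod' fun t _ => ?_) h
  have h0 : M.vnWeight t 0 = 0 := by simp [vnWeight]
  have h1 := choose_mul_pow_le_listCount (M.vnWeight t) 0 h0 (1, M.p) (by simp) (m t) (k t)
  refine le_trans (Nat.mul_le_mul_left _ ?_) h1
  by_cases hq : M.q t = M.p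
  · have : 0 < Nat.card {x // M.vnWeight t x = (1, M.p)} :=
      Nat.card_pos_iff.2 ⟨⟨⟨1, by simp [vnWeight, hq]⟩⟩, inferInstance⟩
    rw [if_pos hq, one_pow]
    exact Nat.pow_pos this
  · simp [hk t hq]

theorem numVN_le_numEdges (n : ℕ) (t : Fin M.nv) : M.numVN n t ≤ M.numEdges n :=
  (Nat.le_mul_of_pos_right _ (M.q_pos t)).trans
    (Finset.single_le_sum (f := fun t => M.numVN n t * M.q t) (fun _ _ => Nat.zero_le _)
      (Finset.mem_univ t))

theorem Admissible.numCN_le_numEdges {n : ℕ} (hn : M.Admissible n) (t : Fin M.nc) :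
    M.numCN n t ≤ M.numEdges n := by
  rw [← hn.card_cSocket]
  simp only [Fintype.card_sigma, Fintype.card_prod, Fintype.card_fin]
  exact (Nat.le_mul_of_pos_right _ (M.s_pos t)).trans
    (Finset.single_le_sum (f := fun t => M.numCN n t * M.s t) (fun _ _ => Nat.zero_le _)
      (Finset.mem_univ t))

/-- Keep only the summand L = p w. The proportions `k` and `l` use the saddle values z^r and x of
the upper bound, so the logarithms reproduce the main term; the quadratic loss comes from the
expansions of the node selections. -/
theorem Admissible.le_log_expectedNum {n : ℕ} (hn : M.Admissible n) {α a : ℝ} (hα : 0 < α)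
    (ha : ∀ t, (M.A t M.r : ℝ) ≤ a) (hax : a * (M.p * M.intLam * α / M.C) ≤ 1)
    (hδα : 1 * (α / M.deltaTilde) ≤ 1) (hθ : M.p * M.intLam * α < 1) {k : Fin M.nc → ℕ}
    (hk : ∀ t, (k t : ℝ) = M.A t M.r * (M.p * M.intLam * α / M.C) * M.numCN n t)
    {l : Fin M.nv → ℕ} (hl : ∀ t, (l t : ℝ) =
      (if M.q t = M.p then 1 else 0 : ℕ) * (α / M.deltaTilde) * M.numVN n t) :
    ∃ w : ℕ, (w : ℝ) = α * n ∧ 0 < M.expectedNum n w ∧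
      n * (M.mainTerm α - (M.p / M.r * a * (M.p * M.intLam / M.C) + 1 / M.deltaTilde) * α ^ 2) -
        (M.nc + M.nv) * Real.log (n / M.intLam + 1) ≤ Real.log (M.expectedNum n w) := by
  have hI := M.intLam_pos
  have hC := M.C_pos
  have hδ := M.deltaTilde_pos
  have hp := M.p_cast_ge
  have hr := M.r_cast_ge
  have hn0 : (0 : ℝ) < n := by exact_mod_cast hn.1
  have hE := hn.numEdges_eq
  have hEpos : (0 : ℝ) < M.numEdges n := by exact_mod_cast hn.numEdges_pos
  have hsumk : ∑ t, (k t : ℝ) = n * (M.p * α / M.r) := by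
    have hsum : (∑ t, (M.rho t : ℝ) * M.A t M.r / M.s t) = M.C / M.r := by
      rw [M.C_eq]; field_simp
    have e : ∀ t, (k t : ℝ) = (M.rho t : ℝ) * M.A t M.r / M.s t * (n * M.p * α / M.C) := by
      intro t
      have hs : (M.s t : ℝ) ≠ 0 := by exact_mod_cast (M.s_pos t).ne'
      rw [hk, hn.numCN_eq]
      field_simp
    rw [Finset.sum_congr rfl fun t _ => e t, ← Finset.sum_mul, hsum]
    field_simp
  have hsuml : ∑ t, (l t : ℝ) = α * n := by
    have e : ∀ t, (l t : ℝ) = (if M.q t = M.p then M.delta t else 0) * (n * α / M.deltaTilde) := by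
      intro t
      rw [hl, hn.numVN_eq]
      split_ifs <;> push_cast <;> ring
    rw [Finset.sum_congr rfl fun t _ => e t, ← Finset.sum_mul, ← Finset.sum_filter]
    change M.deltaTilde * _ = _
    field_simp
  set w := ∑ t, l t with hwdef
  have hw : (w : ℝ) = α * n := by rw [← hsuml, hwdef]; push_cast; rfl
  -- The edges carrying a one agree on both sides; this is the role of the constant C.
  have hkw : (∑ t, k t) * M.r = M.p * w := by
    have : (((∑ t, k t) * M.r : ℕ) : ℝ) = (M.p * w : ℕ) := by
      push_cast
      rw [hsumk, hw]
      field_simp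
    exact_mod_cast this
  obtain ⟨hposk, hlogk⟩ := le_log_prod_choose_mul_pow (M.numCN n) k (fun t => M.A t M.r)
    (x := M.p * M.intLam * α / M.C) (by positivity) hk ha hax hn.numCN_le_numEdges
  obtain ⟨hposl, hlogl⟩ := le_log_prod_choose_mul_pow (M.numVN n) l
    (fun t => if M.q t = M.p then 1 else 0) (x := α / M.deltaTilde) (a := 1) (by positivity) hl
    (fun t => by split_ifs <;> simp) hδα (numVN_le_numEdges n)
  have hck := prod_choose_le_cnCount (M.numCN n) k
  have hcl := prod_choose_le_vnCount (M.numVN n) l (fun t ht => by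
    have := hl t
    rw [if_neg ht] at this
    have h2 : (l t : ℝ) = 0 := by rw [this]; simp
    exact_mod_cast h2)
  rw [hkw] at hck
  rw [← hwdef] at hcl
  have hvpos : 0 < M.vnCount (M.numVN n) w (M.p * w) := hposl.trans_le hcl
  have hcpos : 0 < M.cnCount (M.numCN n) (M.p * w) := hposk.trans_le hck
  have hlogk' := hlogk.trans (Real.log_le_log (by exact_mod_cast hposk)
    (by exact_mod_cast hck : _ ≤ (M.cnCount (M.numCN n) (M.p * w) : ℝ)))
  have hlogl' := hlogl.trans (Real.log_le_log (by exact_mod_cast hposl)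
    (by exact_mod_cast hcl : _ ≤ (M.vnCount (M.numVN n) w (M.p * w) : ℝ)))
  have hpwn : ((M.p * w : ℕ) : ℝ) = n * (M.p * α) := by push_cast; rw [hw]; ring
  have hpwE : ((M.p * w : ℕ) : ℝ) / M.numEdges n = M.p * M.intLam * α := by
    rw [hpwn, hE]
    field_simp
  have hpw : M.p * w < M.numEdges n := by
    rw [← hpwE, div_lt_one hEpos] at hθ
    exact_mod_cast hθ
  have hpw0 : 0 < M.p * w := by
    have : (0 : ℝ) < (M.p * w : ℕ) := by rw [hpwn]; positivity
    exact_mod_cast this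
  have hch : (0 : ℝ) < (M.numEdges n).choose (M.p * w) := by exact_mod_cast Nat.choose_pos hpw.le
  have hterm : (M.vnCount (M.numVN n) w (M.p * w) : ℝ) * M.cnCount (M.numCN n) (M.p * w) /
      (M.numEdges n).choose (M.p * w) ≤ M.expectedNum n w := by
    rw [hn.expectedNum_eq]
    exact Finset.single_le_sum (f := fun L => (M.vnCount (M.numVN n) w L : ℝ) *
      M.cnCount (M.numCN n) L / (M.numEdges n).choose L)
      (fun _ _ => by positivity) (Finset.mem_range.2 (Nat.lt_succ_of_le hpw.le))
  have hv' : (0 : ℝ) < M.vnCount (M.numVN n) w (M.p * w) := by exact_mod_cast hvpos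
  have hc' : (0 : ℝ) < M.cnCount (M.numCN n) (M.p * w) := by exact_mod_cast hcpos
  refine ⟨w, hw, lt_of_lt_of_le (by positivity) hterm, ?_⟩
  refine le_trans ?_ (Real.log_le_log (by positivity) hterm)
  rw [Real.log_div (by positivity) hch.ne', Real.log_mul hv'.ne' hc'.ne']
  have h3 := log_choose_le hpw0 hpw
  rw [hpwE, hE, hpwn] at h3
  have h4 := one_sub_mul_log_one_sub_ge hθ
  have h5 : n * -(M.p * α) ≤
      ((n : ℝ) / M.intLam - n * (M.p * α)) * Real.log (1 - M.p * M.intLam * α) := by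
    have e1 : ((n : ℝ) / M.intLam - n * (M.p * α)) =
        n / M.intLam * (1 - M.p * M.intLam * α) := by field_simp
    rw [e1, mul_assoc]
    refine le_trans (le_of_eq ?_) (mul_le_mul_of_nonneg_left h4 (by positivity))
    field_simp
  rw [hsumk, hE, Fintype.card_fin] at hlogk'
  rw [hsuml, hE, Fintype.card_fin] at hlogl'
  rw [M.mainTerm_eq hα]
  have e2 : (M.p / M.r * a * (M.p * M.intLam / M.C) + 1 / M.deltaTilde) * α ^ 2 =
      M.p * α / M.r * (a * (M.p * M.intLam * α / M.C)) + α * (1 * (α / M.deltaTilde)) := by ring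
  rw [e2]
  linarith

/-- For small rational weights there are arbitrarily large qualifying block lengths, and the growth
rate is at least the main term up to a quadratic error. -/
theorem exists_growth_ge :
    ∃ k ≥ 0, ∃ ε > (0 : ℝ), ∀ α : ℚ, 0 < α → (α : ℝ) ≤ ε →
      (M.growthFilter α).NeBot ∧
      ∀ l, Tendsto (M.normalizedLog α) (M.growthFilter α) (𝓝 l) →
        M.mainTerm α - k * (α : ℝ) ^ 2 ≤ l := by
  have hI := M.intLam_pos
  have hC := M.C_pos
  have hδ := M.deltaTilde_pos
  have hp := M.p_cast_ge
  set a : ℝ := ∑ t, (M.A t M.r : ℝ) + 1 with hadef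
  have hapos : 0 < a := by positivity
  have ha : ∀ t, (M.A t M.r : ℝ) ≤ a := fun t =>
    (Finset.single_le_sum (f := fun t => (M.A t M.r : ℝ)) (fun _ _ => Nat.cast_nonneg _)
      (Finset.mem_univ t)).trans (by linarith)
  refine ⟨M.p / M.r * a * (M.p * M.intLam / M.C) + 1 / M.deltaTilde, by positivity,
    min (1 / (a * (M.p * M.intLam / M.C))) (min M.deltaTilde (1 / (2 * (M.p * M.intLam)))),
    by positivity, fun α hα hle => ?_⟩
  have hα' : (0 : ℝ) < α := by exact_mod_cast hα
  have h1 := (le_div_iff₀ (by positivity)).1 (hle.trans (min_le_left _ _))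
  have h2 := hle.trans ((min_le_right _ _).trans (min_le_left _ _))
  have h3 := (le_div_iff₀ (by positivity)).1
    (hle.trans ((min_le_right _ _).trans (min_le_right _ _)))
  obtain ⟨N, hN, hj⟩ := M.exists_balanced_blockLength α hα.le
  have key : ∀ j : ℕ, 0 < j → M.Admissible (N * j) ∧ ∃ w : ℕ, (w : ℝ) = α * (N * j : ℕ) ∧
      0 < M.expectedNum (N * j) w ∧
      (N * j : ℕ) * (M.mainTerm α -
        (M.p / M.r * a * (M.p * M.intLam / M.C) + 1 / M.deltaTilde) * (α : ℝ) ^ 2) -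
        (M.nc + M.nv) * Real.log ((N * j : ℕ) / M.intLam + 1) ≤
          Real.log (M.expectedNum (N * j) w) := by
    intro j hj0
    obtain ⟨hadm, ⟨k, hk⟩, ⟨l, hl⟩⟩ := hj j hj0
    refine ⟨hadm, hadm.le_log_expectedNum hα' ha ?_ ?_ ?_ hk hl⟩
    · refine le_trans (le_of_eq ?_) h1
      ring
    · rw [one_mul, div_le_one hδ]
      exact h2
    · linarith
  have htop : Tendsto (fun j : ℕ => N * j) atTop atTop := tendsto_id.const_mul_atTop' hN
  have hT : Tendsto (fun j : ℕ => N * j) atTop (M.growthFilter α) := by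
    refine tendsto_inf.2 ⟨htop, tendsto_principal.2 ?_⟩
    filter_upwards [eventually_gt_atTop 0] with j hj0
    obtain ⟨hadm, w, hw, hpos, -⟩ := key j hj0
    exact ⟨hadm, w, hw, hpos⟩
  refine ⟨hT.neBot, fun l hl => ?_⟩
  have hlow := (((tendsto_log_mul_add_one_div _ hI).comp htop).const_mul
    ((M.nc : ℝ) + M.nv)).const_sub (M.mainTerm α -
      (M.p / M.r * a * (M.p * M.intLam / M.C) + 1 / M.deltaTilde) * (α : ℝ) ^ 2)
  rw [mul_zero, sub_zero] at hlow
  refine le_of_tendsto_of_tendsto hlow (hl.comp hT) ?_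
  filter_upwards [eventually_gt_atTop 0] with j hj0
  obtain ⟨hadm, w, hw, hpos, h⟩ := key j hj0
  have hn0 : (0 : ℝ) < (N * j : ℕ) := by exact_mod_cast hadm.1
  simp only [Function.comp]
  rw [normalizedLog, ← hw, Nat.floor_natCast, one_div_mul_eq_div, le_div_iff₀ hn0]
  refine le_trans (le_of_eq ?_) h
  generalize ((N * j : ℕ) : ℝ) = n at hn0 ⊢
  field_simp

/-! ### Weight zero and the conclusion -/

theorem Admissible.expectedNum_zero {n : ℕ} (hn : M.Admissible n) : M.expectedNum n 0 = 1 := by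
  have h : ∀ π : M.Graph n, M.numCodewords π 0 = 1 := by
    intro π
    unfold numCodewords
    rw [Nat.card_eq_one_iff_unique]
    refine ⟨⟨fun x y => Subtype.ext ?_⟩, ⟨⟨0, fun t a => (M.code t).zero_mem, hammingNorm_zero⟩⟩⟩
    rw [hammingNorm_eq_zero.1 x.2.2, hammingNorm_eq_zero.1 y.2.2]
  have hne : Nonempty (M.Graph n) :=
    ⟨Fintype.equivOfCardEq ((card_vSocket n).trans hn.card_cSocket.symm)⟩
  unfold expectedNum
  rw [Finset.sum_congr rfl fun π _ => by rw [h π]]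
  simp

theorem growthFilter_zero_neBot : (M.growthFilter 0).NeBot := by
  obtain ⟨N, hN, hj⟩ := M.exists_balanced_blockLength 0 le_rfl
  have hT : Tendsto (fun j : ℕ => N * j) atTop (M.growthFilter 0) := by
    refine tendsto_inf.2 ⟨tendsto_id.const_mul_atTop' hN, tendsto_principal.2 ?_⟩
    filter_upwards [eventually_gt_atTop 0] with j hj0
    have hadm := (hj j hj0).1
    exact ⟨hadm, 0, by simp, by rw [hadm.expectedNum_zero]; exact one_pos⟩
  exact hT.neBot

theorem tendsto_normalizedLog_zero :
    Tendsto (M.normalizedLog 0) (M.growthFilter 0) (𝓝 0) := by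
  refine tendsto_const_nhds.congr' ?_
  refine eventually_inf_principal.2 (Eventually.of_forall ?_)
  rintro n ⟨hn, -⟩
  simp [normalizedLog, hn.expectedNum_zero]

end GLDPCEnsemble

theorem corollary3 (M : GLDPCEnsemble) :
    ∃ k > (0 : ℝ), ∃ ε > (0 : ℝ), ∀ α : ℚ, 0 ≤ α → (α : ℝ) ≤ ε →
      (M.growthFilter (α : ℝ)).NeBot ∧
      Tendsto (M.normalizedLog (α : ℝ)) (M.growthFilter (α : ℝ)) (𝓝 (M.growthRate (α : ℝ))) ∧
      |M.growthRate (α : ℝ) -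
          (((M.p : ℝ) - (M.p : ℝ) / (M.r : ℝ) - 1) * (α : ℝ) * Real.log (α : ℝ)
            + M.K * (α : ℝ))| ≤ k * (α : ℝ) ^ M.xi := by
  obtain ⟨k₁, hk₁, ε₁, hε₁, h₁⟩ := M.exists_upperExponent_le
  obtain ⟨k₂, hk₂, ε₂, hε₂, h₂⟩ := GLDPCEnsemble.exists_growth_ge (M := M)
  -- The summand 1 makes the constant positive; α ≤ 1 lets the quadratic loss of the lower bound be
  -- absorbed in α^ξ, as ξ ≤ 2.
  refine ⟨k₁ + k₂ + 1, by linarith, min 1 (min ε₁ ε₂), by positivity, fun α hα hle => ?_⟩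
  rcases hα.eq_or_lt with rfl | hpos
  · have hne := GLDPCEnsemble.growthFilter_zero_neBot (M := M)
    have ht := GLDPCEnsemble.tendsto_normalizedLog_zero (M := M)
    have hG : M.growthRate 0 = 0 := ht.limUnder_eq
    rw [Rat.cast_zero, hG]
    refine ⟨hne, ht, ?_⟩
    simp only [mul_zero, zero_mul, add_zero, sub_zero, abs_zero]
    positivity
  · have hα0 : (0 : ℝ) < α := by exact_mod_cast hpos
    have hα1 : (α : ℝ) ≤ 1 := hle.trans (min_le_left _ _)
    obtain ⟨hne, hlow⟩ := h₂ α hpos (hle.trans ((min_le_right _ _).trans (min_le_right _ _)))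
    obtain ⟨hsmall, κ, hκ, x, hx, z, hz, hcond, hup⟩ :=
      h₁ α hα0 (hle.trans ((min_le_right _ _).trans (min_le_left _ _)))
    have hS : (M.qualifying α).Nonempty := by
      have : (𝓟 (M.qualifying α)).NeBot := hne.mono inf_le_right
      exact principal_neBot_iff.1 this
    obtain ⟨l, hl⟩ := GLDPCEnsemble.exists_tendsto_normalizedLog hα0 hsmall hS
    have hG : M.growthRate α = l := hl.limUnder_eq
    rw [hG]
    refine ⟨hne, hl, ?_⟩
    change |l - M.mainTerm α| ≤ _
    have hu := GLDPCEnsemble.growth_le_upperExponent hα0 hκ hx hz hsmall hcond hl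
    have hsq : (α : ℝ) ^ 2 ≤ (α : ℝ) ^ M.xi := by
      have := Real.rpow_le_rpow_of_exponent_ge hα0 hα1 M.xi_le_two
      rwa [Real.rpow_two] at this
    have hxi : 0 ≤ (α : ℝ) ^ M.xi := by positivity
    have h3 := hlow l hl
    have h4 := mul_le_mul_of_nonneg_left hsq hk₂
    have h5 := mul_nonneg hk₁ hxi
    have h6 := mul_nonneg hk₂ hxi
    rw [abs_le]
    constructor <;> nlinarith
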